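/- All digraphs are finite and strict (no loops, no repeated arcs). For $k\geq 2$, $\vec{C}_k$ denotes the directed $k$-cycle. The wreath product $G\wr H$ of digraphs $G$ and $H$ is the digraph on $V(G)\times V(H)$ in which $((g_1,h_1),(g_2,h_2))$ is an arc if and only if $(g_1,g_2)$ is an arc of $G$, or $g_1=g_2$ and $(h_1,h_2)$ is an arc of $H$. A digraph is hamiltonian decomposable if its arc set can be partitioned into the arc sets of one or more directed hamiltonian cycles (spanning directed cycles). Theorem. Let $G$ be a hamiltonian decomposable digraph of even order $n$. The digraph $G\wr\vec{C}_m$ is hamiltonian decomposable in each of the following cases: (S1) $m$ is even, $m\geq 4$, and $n\geq 4$; (S2) $m=4$ and $n=2$; (S3) $m$ is odd and $m\geq 5$. Furthermore, for every even integer $n\geq 2$ and every $m\in\{2,3\}$, the digraph $\vec{C}_n\wr\vec{C}_m$ is not hamiltonian decomposable. -/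

import Mathlib

/-- The directed `k`-cycle, on the vertex set `ℤ/kℤ`, with arcs `(i, i + 1)`.
It is used for `k ≥ 2` only (for `k = 2` it has the two arcs `(0, 1)` and `(1, 0)`). -/
def Digraph.dicycle (k : ℕ) : Digraph (ZMod k) where
  Adj i j := j = i + 1

/-- The wreath (lexicographic) product of two digraphs. -/
def Digraph.wreath {V W : Type*} (G : Digraph V) (H : Digraph W) : Digraph (V × W) where
  Adj p q := G.Adj p.1 q.1 ∨ (p.1 = q.1 ∧ H.Adj p.2 q.2)

/-- `C` is a directed hamiltonian cycle of `G`: a spanning subdigraph of `G` which is isomorphic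
to a directed cycle (of length at least two: a loop is not a cycle). -/
def Digraph.IsHamiltonianDicycle {V : Type*} (C G : Digraph V) : Prop :=
  (∀ u v, C.Adj u v → G.Adj u v) ∧
    ∃ k : ℕ, 2 ≤ k ∧ Nonempty (C.Adj ≃r (Digraph.dicycle k).Adj)

/-- `D` is a decomposition of `G` into directed hamiltonian cycles. Such a decomposition has at
least one member, so an arcless digraph has none. A digraph that has one is automatically
finite and without loops. -/
structure Digraph.IsHamiltonianDecomposition {V : Type*} (G : Digraph V)
    (D : Set (Digraph V)) : Prop where
  nonempty : D.Nonempty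
  isHamiltonianDicycle : ∀ C ∈ D, C.IsHamiltonianDicycle G
  arc_disjoint : ∀ C ∈ D, ∀ C' ∈ D, C ≠ C' → ∀ u v, ¬ (C.Adj u v ∧ C'.Adj u v)
  covers : ∀ u v, G.Adj u v → ∃ C ∈ D, C.Adj u v

/-- A digraph is hamiltonian decomposable if it admits a decomposition into directed
hamiltonian cycles. -/
def Digraph.HamiltonianDecomposable {V : Type*} (G : Digraph V) : Prop :=
  ∃ D : Set (Digraph V), G.IsHamiltonianDecomposition D

/-!
A hamiltonian decomposition is the same as a family of transitive permutations of the vertices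
whose graphs partition the arcs (`Digraph.IsPermDecomposition`), and everything below is about such
families, indexed by colours.

For the positive part, let `g` be one of the cycles of `G`. The arcs over `g` together with the arcs
within the layers, and separately the arcs over each other cycle of `G`, are decomposed. As the
order of `G` is even, the layers along `g` can be grouped into blocks of two consecutive layers.
Suppose that there are a block type in which each colour leaves at the place where it has entered
(`IsPassThrough`), and one in which each colour becomes a single cycle when exits and entries are
identified (`IsLoop`). Then one block of the second type and any number of blocks of the first type
give a decomposition (`Digraph.layered_isPermDecomposition`). Without arcs in the layers, rotations
are such blocks.

With arcs in the layers, blocks are made from two Latin squares of order `m`, seen as families of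
permutations `L c` and `L' c` (`IsLatinCore`). Here `L' c * L c` is transitive for all `c` but one,
and the exceptional permutations are the identity and a permutation with one fixed point and one
further cycle. In each block, an additional colour takes all arcs within the two layers but two,
which are exchanged for two arcs between layers of the exceptional colour (`coreStep`). Following
`L` by the inverses gives the block that passes through, and following `L` by `L'` the block that
closes up. Apart from the exceptional permutations, the Latin squares consist of the translates of
one permutation of `ZMod (m - 1)` each, with a point at infinity inserted where its displacement is
not prescribed (`isLatinCore_translates`). For even `m` it is enough to have a complete mapping `σ`
of `ZMod (m - 1)` with orbits `{0}` and its complement (`hasBlocks_of_odd`), and for odd `m` a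
permutation whose displacements are distinct apart from one point (`hasBlocks_of_perm`). Both are
given by explicit formulas for `m ≥ 6`. The case `m = 5` uses two explicit Latin squares, and
`m = 4` explicit blocks.

The negative part compares signs. A transitive permutation of `n * m` points is odd when `n` is
even. A colour that takes no arcs within the layers is a product of a permutation `π i` for each
layer and of the shift of the layers, which determines the product of the signs of the `π i`
(`prod_sign_of_forall`). A colour that takes one arc in each layer can be completed to a permutation
of this form, at the cost of a cycle of length `n`, and the product changes its sign
(`prod_sign_of_tail`). For `m = 2` and `m = 3` the arcs between two layers are so few that the
colours determine each other, and the resulting relations between signs in each layer contradict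
these products.
-/

/-! ### Decompositions into transitive permutations -/

/-- A family `f` of permutations, indexed by colours, decomposes the digraph `G` into directed
hamiltonian cycles: each `f c` is transitive, and every arc `(u, v)` of `G` satisfies `f c u = v`
for exactly one colour `c`. -/
structure Digraph.IsPermDecomposition {V K : Type*} (G : Digraph V) (f : K → Equiv.Perm V) :
    Prop where
  nonempty : Nonempty K
  sameCycle : ∀ c x y, (f c).SameCycle x y
  adj_iff : ∀ u v, G.Adj u v ↔ ∃ c, f c u = v
  color_inj : ∀ c c' u, f c u = f c' u → c = c'

/-- A transitive permutation of a finite set is conjugate to the rotation of `ZMod`. -/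
theorem Equiv.Perm.exists_equiv_zmod {V : Type*} [Fintype V] {n : ℕ} (hn : Fintype.card V = n)
    (f : Equiv.Perm V) (hf : ∀ x y, f.SameCycle x y) (v : V) :
    ∃ e : ZMod n ≃ V, e 0 = v ∧ ∀ i, f (e i) = e (i + 1) := by
  classical
  subst hn
  have hc : f.IsCycleOn ((Finset.univ : Finset V) : Set V) :=
    ⟨by simp, fun x _ y _ => hf x y⟩
  have : NeZero (Fintype.card V) :=
    haveI : Nonempty V := ⟨v⟩
    ⟨Fintype.card_ne_zero⟩
  have hb : Function.Bijective (fun i : ZMod (Fintype.card V) => (f ^ i.val) v) := by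
    rw [Fintype.bijective_iff_surjective_and_card]
    refine ⟨fun w => ?_, ZMod.card _⟩
    obtain ⟨n, hn, h⟩ := hc.exists_pow_eq (Finset.mem_univ v) (Finset.mem_univ w)
    exact ⟨n, by rw [← h]; simp only; rw [ZMod.val_natCast_of_lt (by simpa using hn)]⟩
  refine ⟨Equiv.ofBijective _ hb, by simp, fun i => ?_⟩
  simp only [Equiv.ofBijective_apply]
  rw [← Equiv.Perm.mul_apply, ← pow_succ']
  refine (hc.pow_apply_eq_pow_apply (Finset.mem_univ v)).2 ?_
  rw [ZMod.val_add]
  have h1 : i.val + 1 ≡ i.val + (1 : ZMod (Fintype.card V)).val [MOD Fintype.card V] :=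
    Nat.ModEq.add_left _ (by
      rw [Nat.ModEq, ← ZMod.val_natCast, Nat.cast_one, Nat.mod_eq_of_lt (ZMod.val_lt _)])
  rw [Finset.card_univ]
  exact h1.trans (Nat.mod_modEq _ _).symm

/-- The graphs of the permutations `f c` are the members of a hamiltonian decomposition. -/
theorem Digraph.IsPermDecomposition.hamiltonianDecomposable {V K : Type*} [Finite V]
    [Nontrivial V] {G : Digraph V} {f : K → Equiv.Perm V} (h : G.IsPermDecomposition f) :
    G.HamiltonianDecomposable := by
  have := Fintype.ofFinite V
  refine ⟨Set.range fun c => ⟨fun u v => f c u = v⟩, ?_, ?_, ?_, ?_⟩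
  · have := h.nonempty
    exact Set.range_nonempty _
  · rintro _ ⟨c, rfl⟩
    refine ⟨fun u v huv => (h.adj_iff u v).2 ⟨c, huv⟩, Fintype.card V,
      Fintype.one_lt_card, ?_⟩
    obtain ⟨v⟩ := (inferInstance : Nonempty V)
    obtain ⟨e, -, he⟩ := (f c).exists_equiv_zmod rfl (h.sameCycle c) v
    refine ⟨⟨e.symm, ?_⟩⟩
    intro a b
    simp only [Digraph.dicycle]
    rw [Equiv.symm_apply_eq, ← he, Equiv.apply_symm_apply, eq_comm]
  · rintro _ ⟨c, rfl⟩ _ ⟨c', rfl⟩ hne u v ⟨h1, h2⟩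
    exact hne (by rw [h.color_inj c c' u (h1.trans h2.symm)])
  · intro u v huv
    obtain ⟨c, hc⟩ := (h.adj_iff u v).1 huv
    exact ⟨_, ⟨c, rfl⟩, hc⟩

/-- A directed hamiltonian cycle is the graph of a transitive permutation. -/
theorem Digraph.IsHamiltonianDicycle.exists_perm {V : Type*} {C G : Digraph V}
    (h : C.IsHamiltonianDicycle G) :
    ∃ f : Equiv.Perm V, (∀ x y, f.SameCycle x y) ∧ ∀ u v, C.Adj u v ↔ f u = v := by
  obtain ⟨-, k, hk, ⟨e⟩⟩ := h
  have : NeZero k := ⟨by omega⟩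
  refine ⟨(e.toEquiv.trans (Equiv.addRight 1)).trans e.toEquiv.symm, fun x y => ?_, fun u v => ?_⟩
  · have key : ∀ n : ℕ, (((e.toEquiv.trans (Equiv.addRight 1)).trans e.toEquiv.symm) ^ n) x
        = e.toEquiv.symm (e.toEquiv x + n) := by
      intro n
      induction n with
      | zero => rw [Nat.cast_zero, add_zero, Equiv.symm_apply_apply, pow_zero, Equiv.Perm.one_apply]
      | succ n ih =>
        rw [pow_succ', Equiv.Perm.mul_apply, ih]
        simp [add_assoc]
    refine ⟨((e.toEquiv y - e.toEquiv x).val : ℤ), ?_⟩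
    rw [zpow_natCast, key, ZMod.natCast_zmod_val, add_sub_cancel, Equiv.symm_apply_apply]
  · rw [← e.map_rel_iff]
    simp only [Digraph.dicycle, Equiv.trans_apply, Equiv.symm_apply_eq, Equiv.coe_addRight]
    exact eq_comm

/-- A hamiltonian decomposition is a decomposition into transitive permutations, with its members
as colours. -/
theorem Digraph.HamiltonianDecomposable.exists_isPermDecomposition {V : Type*} {G : Digraph V}
    (h : G.HamiltonianDecomposable) :
    ∃ (D : Set (Digraph V)) (f : D → Equiv.Perm V), G.IsPermDecomposition f := by
  obtain ⟨D, hD⟩ := h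
  choose f hf hadj using fun C : D => (hD.isHamiltonianDicycle C.1 C.2).exists_perm
  refine ⟨D, f, hD.nonempty.to_subtype, hf, fun u v => ⟨fun huv => ?_, ?_⟩, ?_⟩
  · obtain ⟨C, hC, hu⟩ := hD.covers u v huv
    exact ⟨⟨C, hC⟩, (hadj ⟨C, hC⟩ u v).1 hu⟩
  · rintro ⟨C, hC⟩
    exact (hD.isHamiltonianDicycle C.1 C.2).1 u v ((hadj C u v).2 hC)
  · intro C C' u hu
    by_contra hne
    refine hD.arc_disjoint C.1 C.2 C'.1 C'.2 (fun h => hne (Subtype.ext h)) u (f C u)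
      ⟨(hadj C _ _).2 rfl, (hadj C' _ _).2 hu.symm⟩

/-! ### Blocks of two consecutive layers -/

/-- A decomposition is transported along an isomorphism of digraphs. -/
theorem Digraph.IsPermDecomposition.map {V W K : Type*} {G : Digraph V} {H : Digraph W}
    {f : K → Equiv.Perm V} (h : G.IsPermDecomposition f) (e : V ≃ W)
    (he : ∀ u v, G.Adj u v ↔ H.Adj (e u) (e v)) :
    H.IsPermDecomposition fun c => e.permCongr (f c) where
  nonempty := h.nonempty
  sameCycle c x y := by
    obtain ⟨i, hi⟩ := h.sameCycle c (e.symm x) (e.symm y)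
    refine ⟨i, ?_⟩
    have : (e.permCongr (f c)) ^ i = e.permCongr (f c ^ i) :=
      (map_zpow e.permCongrHom (f c) i).symm
    rw [this, Equiv.permCongr_apply, hi, Equiv.apply_symm_apply]
  adj_iff u v := by
    have := (he (e.symm u) (e.symm v)).symm.trans (h.adj_iff _ _)
    simpa [Equiv.permCongr_apply, ← Equiv.eq_symm_apply] using this
  color_inj c c' u hu := h.color_inj c c' (e.symm u) (by simpa [Equiv.permCongr_apply] using hu)

/-- `Digraph.layered m g vert` replaces every vertex of the digraph `x ↦ g x` by a layer of `m`
independent vertices or, if `vert` holds, by a directed `m`-cycle. -/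
def Digraph.layered {V : Type*} (m : ℕ) (g : Equiv.Perm V) (vert : Prop) :
    Digraph (V × ZMod m) where
  Adj u v := g u.1 = v.1 ∨ (vert ∧ u.1 = v.1 ∧ v.2 = u.2 + 1)

/-- The arcs that start in a block of two consecutive layers, which are the vertices `(false, x)`
and `(true, x)`. An arc ends in the block, at `Sum.inl p`, or at the vertex `y` of the first layer
of the next block, encoded as `Sum.inr y`. The second layer is labelled by `-x` in place of `x`, so
that its arcs within the layer go from `x` to `x - 1`. -/
def blockArc (m : ℕ) (vert : Prop) : Bool × ZMod m → (Bool × ZMod m) ⊕ ZMod m → Prop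
  | (false, x), .inl (false, y) => vert ∧ y = x + 1
  | (false, _), .inl (true, _) => True
  | (false, _), .inr _ => False
  | (true, _), .inl (false, _) => False
  | (true, x), .inl (true, y) => vert ∧ y = x - 1
  | (true, _), .inr _ => True

/-- `s` partitions the arcs of a block among the colours `c : K` in such a way that the arcs of
each colour `c` that enter the block end in the set `E c`. -/
structure IsBlock {m : ℕ} {K : Type*} (vert : Prop) (E : K → Set (ZMod m))
    (s : K → Bool × ZMod m → (Bool × ZMod m) ⊕ ZMod m) : Prop where
  arc : ∀ c p, blockArc m vert p (s c p)
  covers : ∀ p t, blockArc m vert p t → ∃ c, s c p = t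
  color_inj : ∀ c c' p, s c p = s c' p → c = c'
  injective : ∀ c, Function.Injective (s c)
  mem_of_exit : ∀ c p y, s c p = .inr y → y ∈ E c
  notMem_of_stay : ∀ c p y, s c p = .inl (false, y) → y ∉ E c

/-- Each colour leaves the block at the place where it has entered it. -/
def IsPassThrough {m : ℕ} {K : Type*} (E : K → Set (ZMod m))
    (s : K → Bool × ZMod m → (Bool × ZMod m) ⊕ ZMod m) : Prop :=
  ∀ c, (∀ x ∈ E c, Relation.EqvGen (fun a b => ∃ p, a = .inl p ∧ b = s c p)
      (.inl (false, x)) (.inr x)) ∧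
    ∀ p, ∃ x ∈ E c, Relation.EqvGen (fun a b => ∃ p, a = .inl p ∧ b = s c p)
      (.inl p) (.inl (false, x))

/-- Each colour becomes a single cycle when the exits of the block are identified with its
entries. -/
def IsLoop {m : ℕ} {K : Type*} (s : K → Bool × ZMod m → (Bool × ZMod m) ⊕ ZMod m) : Prop :=
  ∀ c p q, Relation.EqvGen (fun a b => Sum.elim id (fun y => (false, y)) (s c a) = b) p q

/-- The endpoint of an arc that starts in the block with index `j`. -/
def blockOut {k m : ℕ} (j : ZMod k) : (Bool × ZMod m) ⊕ ZMod m → ZMod k × Bool × ZMod m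
  | .inl p => (j, p)
  | .inr y => (j + 1, false, y)

/-- `k` blocks in cyclic order, one of them of type `s` and the others of type `s'`. -/
def blockMap {k m : ℕ} {K : Type*} (s s' : K → Bool × ZMod m → (Bool × ZMod m) ⊕ ZMod m) (c : K)
    (u : ZMod k × Bool × ZMod m) : ZMod k × Bool × ZMod m :=
  blockOut u.1 (if u.1 = 0 then s c u.2 else s' c u.2)

/-- A block may be the only one, so that its exits are its own entries. Even then the arcs that
start at the same vertex have different endpoints, since arcs to the first layer start in the first
layer if they stay in the block, and in the second layer otherwise. -/
theorem blockOut_inj {k m : ℕ} {vert : Prop} {j : ZMod k} {p : Bool × ZMod m}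
    {t t' : (Bool × ZMod m) ⊕ ZMod m} (ht : blockArc m vert p t) (ht' : blockArc m vert p t')
    (h : blockOut j t = blockOut j t') : t = t' := by
  obtain ⟨b, x⟩ := p
  rcases t with ⟨b1, y⟩ | y <;> rcases t' with ⟨b2, y'⟩ | y' <;> cases b <;>
    simp_all [blockOut, blockArc]

/-- Both block types are entered by colour `c` at the places in `E c`, and no arc of colour `c`
inside a block ends there. -/
theorem blockMap_injective {k m : ℕ} {K : Type*} {vert : Prop} {E : K → Set (ZMod m)}
    {s s' : K → Bool × ZMod m → (Bool × ZMod m) ⊕ ZMod m} (h : IsBlock vert E s)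
    (h' : IsBlock vert E s') (c : K) :
    Function.Injective (blockMap (k := k) s s' c) := by
  have main : ∀ j : ZMod k, ∃ r, IsBlock vert E r ∧ ∀ p,
      (if j = 0 then s c p else s' c p) = r c p := by
    intro j
    by_cases hj : j = 0
    · exact ⟨s, h, fun p => by simp [hj]⟩
    · exact ⟨s', h', fun p => by simp [hj]⟩
  rintro ⟨j, p⟩ ⟨j', p'⟩ heq
  obtain ⟨r, hr, hrp⟩ := main j
  obtain ⟨r', hr', hrp'⟩ := main j'
  simp only [blockMap, hrp, hrp'] at heq
  rcases e : r c p with q | y <;> rcases e' : r' c p' with q' | y' <;>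
    simp only [e, e', blockOut, Prod.mk.injEq] at heq
  · obtain ⟨rfl, rfl⟩ := heq
    rw [← hrp] at e
    rw [← hrp'] at e'
    rw [hrp] at e e'
    rw [hr.injective c (e.trans e'.symm)]
  · obtain ⟨-, rfl⟩ := heq
    exact absurd (hr'.mem_of_exit _ _ _ e') (hr.notMem_of_stay _ _ _ e)
  · obtain ⟨-, rfl⟩ := heq
    exact absurd (hr.mem_of_exit _ _ _ e) (hr'.notMem_of_stay _ _ _ e')
  · obtain ⟨hj, -, rfl⟩ := heq
    obtain rfl : j = j' := by simpa using hj
    rw [← hrp] at e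
    rw [← hrp'] at e'
    rw [hrp] at e e'
    rw [hr.injective c (e.trans e'.symm)]

theorem Equiv.Perm.sameCycle_of_eqvGen {α β : Type*} {f : Equiv.Perm β} {r : α → α → Prop}
    (g : α → β) (hg : ∀ a b, r a b → f.SameCycle (g a) (g b)) {a b : α}
    (h : Relation.EqvGen r a b) : f.SameCycle (g a) (g b) := by
  induction h with
  | rel a b h => exact hg a b h
  | refl a => exact Equiv.Perm.SameCycle.refl _ _
  | symm a b _ ih => exact ih.symm
  | trans a b c _ _ ih1 ih2 => exact ih1.trans ih2

/-- A block that passes through can be contracted, so only the block with index `0`, which closes up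
to a single cycle, remains. -/
theorem sameCycle_of_isLoop {k m : ℕ} [NeZero k] {K : Type*} {vert : Prop}
    {E : K → Set (ZMod m)} {s s' : K → Bool × ZMod m → (Bool × ZMod m) ⊕ ZMod m}
    (h : IsBlock vert E s) (hs : IsLoop s) (hs' : IsPassThrough E s')
    {c : K} {f : Equiv.Perm (ZMod k × Bool × ZMod m)} (hf : ∀ u, f u = blockMap s s' c u)
    (u v : ZMod k × Bool × ZMod m) : f.SameCycle u v := by
  have step : ∀ u w, f u = w → f.SameCycle u w := by
    rintro u _ rfl
    exact Equiv.Perm.sameCycle_apply_right.2 (Equiv.Perm.SameCycle.refl _ _)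
  have stay : ∀ j : ZMod k, j ≠ 0 → ∀ a b, (∃ p, a = .inl p ∧ b = s' c p) →
      f.SameCycle (blockOut j a) (blockOut j b) := by
    rintro j hj _ _ ⟨p, rfl, rfl⟩
    exact step _ _ (by rw [hf, blockMap]; simp [blockOut, hj])
  have next : ∀ j : ZMod k, j ≠ 0 → ∀ x ∈ E c, f.SameCycle (j, false, x) (j + 1, false, x) :=
    fun j hj x hx => Equiv.Perm.sameCycle_of_eqvGen (blockOut j) (stay j hj) ((hs' c).1 x hx)
  -- the blocks `i, i + 1, …, k - 1` all pass through, and are followed by the block `0`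
  have toZero : ∀ d i : ℕ, i + d = k → 1 ≤ i → ∀ x ∈ E c,
      f.SameCycle ((i : ZMod k), false, x) (0, false, x) := by
    intro d
    induction d with
    | zero =>
      intro i hi _ x _
      rw [(ZMod.natCast_eq_zero_iff i k).2 (by rw [← hi, Nat.add_zero])]
    | succ d ih =>
      intro i hi h1 x hx
      have h0 : (i : ZMod k) ≠ 0 := by
        rw [Ne, ZMod.natCast_eq_zero_iff]
        exact fun hd => absurd (Nat.le_of_dvd h1 hd) (by omega)
      have := ih (i + 1) (by omega) (by omega) x hx
      rw [Nat.cast_succ] at this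
      exact (next _ h0 x hx).trans this
  have loop : ∀ a b, Sum.elim id (fun y => (false, y)) (s c a) = b →
      f.SameCycle ((0 : ZMod k), a) (0, b) := by
    rintro a _ rfl
    have h1 : f ((0 : ZMod k), a) = blockOut 0 (s c a) := by simp [hf, blockMap]
    rcases e : s c a with q | y
    · exact step _ _ (by rw [h1, e]; rfl)
    · refine (step _ _ (h1.trans (by rw [e]))).trans ?_
      have := toZero (k - 1) 1 (by have := NeZero.pos k; omega) le_rfl y (h.mem_of_exit _ _ _ e)
      simpa [blockOut] using this
  have all : ∀ u : ZMod k × Bool × ZMod m, f.SameCycle u (0, false, 0) := by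
    rintro ⟨j, p⟩
    have zero : ∀ q, f.SameCycle ((0 : ZMod k), q) (0, false, 0) := fun q =>
      Equiv.Perm.sameCycle_of_eqvGen (fun p => ((0 : ZMod k), p)) loop (hs c q (false, 0))
    by_cases hj : j = 0
    · subst hj
      exact zero p
    · obtain ⟨x, hx, hp⟩ := (hs' c).2 p
      refine (Equiv.Perm.sameCycle_of_eqvGen (blockOut j) (stay j hj) hp).trans ?_
      have hv : j.val ≠ 0 := by rwa [Ne, ZMod.val_eq_zero]
      have := toZero (k - j.val) j.val (by have := ZMod.val_lt j; omega) (by omega) x hx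
      rw [ZMod.natCast_zmod_val] at this
      exact this.trans (zero _)
  exact (all u).trans (all v).symm

/-- A transitive permutation of a set with `2 * k` elements runs through `k` blocks of size
two. -/
theorem Equiv.Perm.exists_equiv_zmod_prod_bool {V : Type*} [Fintype V] {k : ℕ} [NeZero k]
    (hV : Fintype.card V = 2 * k) (g : Equiv.Perm V) (hg : ∀ x y, g.SameCycle x y) :
    ∃ e : ZMod k × Bool ≃ V, (∀ j, g (e (j, false)) = e (j, true)) ∧
      ∀ j, g (e (j, true)) = e (j + 1, false) := by
  have hk := NeZero.pos k
  obtain ⟨v⟩ : Nonempty V := Fintype.card_pos_iff.1 (by omega)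
  obtain ⟨e, -, he⟩ := g.exists_equiv_zmod hV hg v
  have hb : Function.Bijective fun p : ZMod k × Bool =>
      e ((2 * p.1.val + p.2.toNat : ℕ) : ZMod (2 * k)) := by
    rw [Fintype.bijective_iff_injective_and_card]
    refine ⟨?_, by simp [hV, ZMod.card, mul_comm]⟩
    rintro ⟨a, b⟩ ⟨a', b'⟩ hab
    have h1 := congrArg ZMod.val (e.injective hab)
    have ha := ZMod.val_lt a
    have ha' := ZMod.val_lt a'
    have hb := Bool.toNat_le b
    have hb' := Bool.toNat_le b'
    dsimp only at h1
    rw [ZMod.val_natCast_of_lt (by omega), ZMod.val_natCast_of_lt (by omega)] at h1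
    rw [Prod.mk.injEq]
    exact ⟨ZMod.val_injective k (by omega), by
      have : b.toNat = b'.toNat := by omega
      cases b <;> cases b' <;> simp_all⟩
  refine ⟨Equiv.ofBijective _ hb, fun j => ?_, fun j => ?_⟩
  · simp [he]
  · simp only [Equiv.ofBijective_apply, he]
    congr 1
    have h2 : 2 * (j.val + 1) ≡ 2 * (j + 1).val [MOD 2 * k] := by
      rw [ZMod.val_add, ZMod.val_one_eq_one_mod, Nat.add_mod_mod]
      exact Nat.ModEq.mul_left' 2 (Nat.mod_modEq _ _).symm
    have := (ZMod.natCast_eq_natCast_iff _ _ _).2 h2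
    push_cast at this ⊢
    simp only [Bool.toNat_true, Bool.toNat_false, Nat.cast_one, Nat.cast_zero, add_zero]
    rw [← this]
    ring

/-- Block types that close up and that pass through can be combined into a decomposition over any
directed cycle of even length. -/
theorem Digraph.layered_isPermDecomposition {V K : Type*} [Fintype V] [Nonempty K] {k m : ℕ}
    [NeZero k] [NeZero m] (hV : Fintype.card V = 2 * k) {g : Equiv.Perm V}
    (hg : ∀ x y, g.SameCycle x y)
    {vert : Prop} {E : K → Set (ZMod m)} {s s' : K → Bool × ZMod m → (Bool × ZMod m) ⊕ ZMod m}
    (h : IsBlock vert E s) (h' : IsBlock vert E s') (hs : IsLoop s) (hs' : IsPassThrough E s') :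
    ∃ f : K → Equiv.Perm (V × ZMod m), (Digraph.layered m g vert).IsPermDecomposition f := by
  obtain ⟨e, he1, he2⟩ := g.exists_equiv_zmod_prod_bool hV hg
  let f : K → Equiv.Perm (ZMod k × Bool × ZMod m) := fun c =>
    Equiv.ofBijective _ (Finite.injective_iff_bijective.1 (blockMap_injective h h' c))
  have arc : ∀ (j : ZMod k) c p, blockArc m vert p (if j = 0 then s c p else s' c p) := by
    intro j c p
    split_ifs
    exacts [h.arc c p, h'.arc c p]
  let G : Digraph (ZMod k × Bool × ZMod m) :=
    ⟨fun u v => ∃ t, blockArc m vert u.2 t ∧ blockOut u.1 t = v⟩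
  have hG : G.IsPermDecomposition f := by
    refine ⟨inferInstance, fun c => sameCycle_of_isLoop h hs hs' fun u => rfl, ?_, ?_⟩
    · rintro ⟨j, p⟩ v
      constructor
      · rintro ⟨t, ht, rfl⟩
        by_cases hj : j = 0
        · obtain ⟨c, hc⟩ := h.covers p t ht
          exact ⟨c, by simp [f, blockMap, hj, hc]⟩
        · obtain ⟨c, hc⟩ := h'.covers p t ht
          exact ⟨c, by simp [f, blockMap, hj, hc]⟩
      · rintro ⟨c, rfl⟩
        exact ⟨_, arc j c p, rfl⟩
    · rintro c c' ⟨j, p⟩ hu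
      have := blockOut_inj (arc j c p) (arc j c' p) hu
      split_ifs at this
      exacts [h.color_inj _ _ _ this, h'.color_inj _ _ _ this]
  -- the second layer of each block is labelled by `-x` in place of `x`
  refine ⟨_, hG.map ((Equiv.prodAssoc _ _ _).symm.trans
    (Equiv.prodShear e fun p => if p.2 then Equiv.neg _ else Equiv.refl _)) ?_⟩
  rintro ⟨j, b, x⟩ ⟨j', b', y⟩
  simp only [G, Digraph.layered, Equiv.trans_apply, Equiv.prodAssoc_symm_apply,
    Equiv.prodShear_apply]
  cases b
  · rw [he1, e.apply_eq_iff_eq, e.apply_eq_iff_eq]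
    constructor
    · rintro ⟨t | t, ht, heq⟩
      · obtain ⟨b1, z⟩ := t
        simp only [blockOut, Prod.mk.injEq] at heq
        obtain ⟨rfl, rfl, rfl⟩ := heq
        cases b1 <;> simp_all [blockArc]
      · exact ht.elim
    · rintro (heq | ⟨hv, heq, hy⟩)
      · simp only [Prod.mk.injEq] at heq
        obtain ⟨rfl, rfl⟩ := heq
        exact ⟨.inl (true, y), trivial, rfl⟩
      · simp only [Prod.mk.injEq] at heq
        obtain ⟨rfl, rfl⟩ := heq
        exact ⟨.inl (false, y), ⟨hv, by simpa using hy⟩, rfl⟩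
  · rw [he2, e.apply_eq_iff_eq, e.apply_eq_iff_eq]
    constructor
    · rintro ⟨t | t, ht, heq⟩
      · obtain ⟨b1, z⟩ := t
        simp only [blockOut, Prod.mk.injEq] at heq
        obtain ⟨rfl, rfl, rfl⟩ := heq
        cases b1
        · exact ht.elim
        · obtain ⟨hv, rfl⟩ := ht
          exact Or.inr ⟨hv, rfl, by simp; ring⟩
      · simp only [blockOut, Prod.mk.injEq] at heq
        exact Or.inl (by simp [heq.1, heq.2.1])
    · rintro (heq | ⟨hv, heq, hy⟩)
      · simp only [Prod.mk.injEq] at heq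
        obtain ⟨rfl, rfl⟩ := heq
        exact ⟨.inr y, trivial, rfl⟩
      · simp only [Prod.mk.injEq] at heq
        obtain ⟨rfl, rfl⟩ := heq
        refine ⟨.inl (true, y), ⟨hv, ?_⟩, rfl⟩
        simp only [if_true, Equiv.neg_apply] at hy
        rw [← neg_inj, hy]
        ring

/-! ### Blocks from pairs of Latin squares -/

/-- Two Latin squares `L` and `L'` of permutations of `X`, with rows indexed by `K`, such that the
composites `L' c * L c` are transitive, except for a special row `k₀` for which `L k₀` is the
identity and `L' k₀` fixes `v` and is transitive on the other points. -/
structure IsLatinCore {X K : Type*} (k₀ : K) (v : X) (L L' : K → Equiv.Perm X) : Prop where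
  latin : ∀ x y, ∃! c, L c x = y
  latin' : ∀ x y, ∃! c, L' c x = y
  eq_one : L k₀ = 1
  fixed : L' k₀ v = v
  sameCycle : ∀ x y, x ≠ v → y ≠ v → (L' k₀).SameCycle x y
  sameCycle_mul : ∀ c ≠ k₀, ∀ x y, (L' c * L c).SameCycle x y

/-- An equivalence relation that relates each point to its image contains the orbit relation. -/
theorem Equiv.Perm.SameCycle.rel {α : Type*} {f : Equiv.Perm α} {r : α → α → Prop}
    (hr : Equivalence r) (h : ∀ x, r x (f x)) {x y : α} (hxy : f.SameCycle x y) : r x y := by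
  have hn : ∀ (n : ℕ) x, r x ((f ^ n) x) := by
    intro n
    induction n with
    | zero => exact hr.refl
    | succ n ih =>
      intro x
      rw [pow_succ, Equiv.Perm.mul_apply]
      exact hr.trans (h x) (ih _)
  obtain ⟨i, rfl⟩ := hxy
  obtain ⟨n, rfl | rfl⟩ := i.eq_nat_or_neg
  · exact hn n x
  · have := hn n ((f ^ (-(n : ℤ))) x)
    rw [← Equiv.Perm.mul_apply, ← zpow_natCast, ← zpow_add, add_neg_cancel, zpow_zero] at this
    exact hr.symm this

theorem IsLatinCore.permCongr {X Y K : Type*} {k₀ : K} {v : X} {L L' : K → Equiv.Perm X}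
    (h : IsLatinCore k₀ v L L') (e : X ≃ Y) :
    IsLatinCore k₀ (e v) (fun c => e.permCongr (L c)) fun c => e.permCongr (L' c) := by
  have same : ∀ (f : Equiv.Perm X) x y, f.SameCycle (e.symm x) (e.symm y) →
      (e.permCongr f).SameCycle x y := by
    rintro f x y ⟨i, hi⟩
    refine ⟨i, ?_⟩
    have : (e.permCongr f) ^ i = e.permCongr (f ^ i) := (map_zpow e.permCongrHom f i).symm
    rw [this, Equiv.permCongr_apply, hi, Equiv.apply_symm_apply]
  refine ⟨fun x y => ?_, fun x y => ?_, ?_, ?_, fun x y hx hy => ?_, fun c hc x y => ?_⟩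
  · simpa [Equiv.permCongr_apply, ← Equiv.eq_symm_apply] using h.latin (e.symm x) (e.symm y)
  · simpa [Equiv.permCongr_apply, ← Equiv.eq_symm_apply] using h.latin' (e.symm x) (e.symm y)
  · ext x
    simp [h.eq_one]
  · simp [h.fixed]
  · exact same _ _ _ (h.sameCycle _ _ (fun h => hx (by simp [← h])) fun h => hy (by simp [← h]))
  · have : e.permCongr (L' c) * e.permCongr (L c) = e.permCongr (L' c * L c) :=
      (map_mul e.permCongrHom _ _).symm
    rw [this]
    exact same _ _ _ (h.sameCycle_mul c hc _ _)

section CoreStep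

open Classical in
/-- The block made from a Latin square `L`, which is used from the first layer to the second, and a
Latin square `M`, which is used to leave the second layer. The colour `some k₀` takes one arc in
each of the layers, and gives the two arcs `0 → 0` and `1 → 1` between layers to the additional
colour `none`, which takes all other arcs in the layers. -/
noncomputable def coreStep {m : ℕ} {K : Type*} (k₀ : K) (L M : K → Equiv.Perm (ZMod m)) :
    Option K → Bool × ZMod m → (Bool × ZMod m) ⊕ ZMod m
  | some c, (false, x) => if c = k₀ ∧ x = 0 then .inl (false, 1) else .inl (true, L c x)
  | some c, (true, x) => if c = k₀ ∧ x = 1 then .inl (true, 0) else .inr (M c x)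
  | none, (false, x) => if x = 0 then .inl (true, 0) else .inl (false, x + 1)
  | none, (true, x) => if x = 1 then .inr 1 else .inl (true, x - 1)

/-- The places at which a colour enters a block made from Latin squares. -/
def coreEntry (m : ℕ) {K : Type*} (k₀ : K) : Option K → Set (ZMod m)
  | some c => {x | c = k₀ → x ≠ 1}
  | none => {1}

variable {m : ℕ} {K : Type*} {k₀ : K} {L M : K → Equiv.Perm (ZMod m)}

/-- This is used with `M = L'`, and with `M` the family of the inverses of the `L c`. -/
theorem isBlock_coreStep (hL : ∀ x y, ∃! c, L c x = y) (hM : ∀ x y, ∃! c, M c x = y)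
    (h1 : L k₀ = 1) (hf : M k₀ 1 = 1) :
    IsBlock True (coreEntry m k₀) (coreStep k₀ L M) := by
  have L0 : ∀ x, L k₀ x = x := fun x => by rw [h1]; rfl
  have Linj : ∀ c c' x, L c x = L c' x → c = c' := fun c c' x h => (hL x _).unique h rfl
  have Minj : ∀ c c' x, M c x = M c' x → c = c' := fun c c' x h => (hM x _).unique h rfl
  have M1 : ∀ x, M k₀ x = 1 → x = 1 := fun x hx => (M k₀).injective (hx.trans hf.symm)
  refine ⟨?_, ?_, ?_, ?_, ?_, ?_⟩
  · rintro (_ | c) ⟨_ | _, x⟩ <;> simp only [coreStep] <;> split_ifs with h <;>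
      simp [blockArc, h]
  · rintro ⟨_ | _, x⟩ (⟨_ | _, y⟩ | y) h
    · obtain ⟨-, rfl⟩ := h
      by_cases hx : x = 0
      · exact ⟨some k₀, by simp [coreStep, hx]⟩
      · exact ⟨none, by simp [coreStep, hx]⟩
    · obtain ⟨c, hc, -⟩ := hL x y
      by_cases hcx : c = k₀ ∧ x = 0
      · obtain ⟨rfl, rfl⟩ := hcx
        exact ⟨none, by simp [coreStep, ← hc, L0]⟩
      · exact ⟨some c, by simp only [coreStep, if_neg hcx, hc]⟩
    · exact h.elim
    · exact h.elim
    · obtain ⟨-, rfl⟩ := h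
      by_cases hx : x = 1
      · exact ⟨some k₀, by simp [coreStep, hx]⟩
      · exact ⟨none, by simp [coreStep, hx]⟩
    · obtain ⟨c, hc, -⟩ := hM x y
      by_cases hcx : c = k₀ ∧ x = 1
      · obtain ⟨rfl, rfl⟩ := hcx
        exact ⟨none, by simp [coreStep, ← hc, hf]⟩
      · exact ⟨some c, by simp only [coreStep, if_neg hcx, hc]⟩
  · have key : ∀ c p, coreStep k₀ L M none p ≠ coreStep k₀ L M (some c) p := by
      rintro c ⟨_ | _, x⟩ h
      · by_cases hx : x = 0
        · subst hx
          by_cases hc : c = k₀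
          · simp [coreStep, hc] at h
          · simp only [coreStep, hc, false_and, if_false, if_true, Sum.inl.injEq,
              Prod.mk.injEq, true_and] at h
            exact hc (Linj _ _ 0 (h.symm.trans (L0 0).symm))
        · simp [coreStep, hx] at h
      · by_cases hx : x = 1
        · subst hx
          by_cases hc : c = k₀
          · simp [coreStep, hc] at h
          · simp only [coreStep, hc, false_and, if_false, if_true, Sum.inr.injEq] at h
            exact hc (Minj _ _ 1 (h.symm.trans hf.symm))
        · simp [coreStep, hx] at h
    rintro (_ | c) (_ | c') p h
    · rfl
    · exact (key _ _ h).elim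
    · exact (key _ _ h.symm).elim
    · obtain ⟨_ | _, x⟩ := p
      · simp only [coreStep] at h
        split_ifs at h with h2 h3 h3
        · rw [h2.1, h3.1]
        · simp at h
        · simp at h
        · simp only [Sum.inl.injEq, Prod.mk.injEq, true_and] at h
          rw [Linj _ _ _ h]
      · simp only [coreStep] at h
        split_ifs at h with h2 h3 h3
        · rw [h2.1, h3.1]
        · simp only [Sum.inr.injEq] at h
          rw [Minj _ _ _ h]
  · rintro (_ | c) ⟨_ | _, x⟩ ⟨_ | _, y⟩ h <;> simp only [coreStep] at h <;>
      split_ifs at h with h2 h3 h3 <;>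
      simp only [Sum.inl.injEq, Sum.inr.injEq, Prod.mk.injEq, reduceCtorEq, true_and, false_and,
        EmbeddingLike.apply_eq_iff_eq, add_left_inj, sub_left_inj] at h
    · rw [h2, h3]
    · rw [h]
    · exact (h3 (sub_eq_zero.1 h.symm)).elim
    · exact (h2 (sub_eq_zero.1 h)).elim
    · rw [h2, h3]
    · rw [h]
    · rw [h2.2, h3.2]
    · rw [h]
    · exact (h2 ⟨h3.1, by rw [← h, h3.1, L0]⟩).elim
    · exact (h3 ⟨h2.1, by rw [h, h2.1, L0]⟩).elim
    · rw [h2.2, h3.2]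
    · rw [h]
  · rintro (_ | c) ⟨_ | _, x⟩ y h <;> simp only [coreStep] at h <;> split_ifs at h with h2
    · exact (Sum.inr.inj h).symm
    · rintro rfl rfl
      exact h2 ⟨rfl, M1 _ (Sum.inr.inj h)⟩
  · rintro (_ | c) ⟨_ | _, x⟩ y h <;> simp only [coreStep] at h <;> split_ifs at h with h2
    · simp at h
    · simp only [Sum.inl.injEq, Prod.mk.injEq, true_and] at h
      rw [← h, coreEntry, Set.mem_singleton_iff, add_eq_right]
      exact h2
    · simp at h
    · simp only [Sum.inl.injEq, Prod.mk.injEq, true_and] at h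
      exact fun hy => hy h2.1 h.symm
    · simp at h
    · simp at h

/-- The colour `none` runs through all vertices of the block: it goes round the first layer from
`1` to `0`, and then round the second layer from `0` to `1`. -/
theorem coreStep_none_rel [NeZero m] {α : Type*} {r : α → α → Prop} (hr : Equivalence r)
    (g : Bool × ZMod m → α) (h : ∀ p q, coreStep k₀ L M none p = .inl q → r (g p) (g q))
    (p : Bool × ZMod m) : r (g p) (g (true, 1)) := by
  have up : ∀ n : ℕ, n < m → r (g (false, (0 : ZMod m) - n)) (g (true, 0)) := by
    intro n
    induction n with
    | zero => exact fun _ => h _ _ (by simp [coreStep])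
    | succ n ih =>
      intro hn
      refine hr.trans (h _ _ ?_) (ih (by omega))
      have : (0 : ZMod m) - (n + 1 : ℕ) ≠ 0 := by
        rw [zero_sub, neg_ne_zero, Ne, ZMod.natCast_eq_zero_iff]
        exact Nat.not_dvd_of_pos_of_lt (by omega) hn
      rw [coreStep, if_neg this, Nat.cast_succ]
      congr 2
      ring
  have down : ∀ n : ℕ, n < m → r (g (true, (1 : ZMod m) + n)) (g (true, 1)) := by
    intro n
    induction n with
    | zero => exact fun _ => by simpa using hr.refl _
    | succ n ih =>
      intro hn
      refine hr.trans (h _ _ ?_) (ih (by omega))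
      have : (1 : ZMod m) + (n + 1 : ℕ) ≠ 1 := by
        rw [Ne, add_eq_left, ZMod.natCast_eq_zero_iff]
        exact Nat.not_dvd_of_pos_of_lt (by omega) hn
      rw [coreStep, if_neg this, Nat.cast_succ]
      congr 2
      ring
  have down' : ∀ x, r (g (true, x)) (g (true, 1)) := fun x => by
    have := down (x - 1).val (ZMod.val_lt _)
    rwa [ZMod.natCast_zmod_val, add_sub_cancel] at this
  obtain ⟨_ | _, x⟩ := p
  · have := up (0 - x).val (ZMod.val_lt _)
    rw [ZMod.natCast_zmod_val, sub_sub_cancel] at this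
    exact hr.trans this (down' 0)
  · exact down' x

/-- The second layer undoes the permutation `L c` of the first one. The colour `some k₀` passes
straight through, except that it enters at `0`, goes to `1` in the first layer and returns from `1`
to `0` in the second. -/
theorem isPassThrough_coreStep [NeZero m] (hm : 2 ≤ m) (h1 : L k₀ = 1) :
    IsPassThrough (coreEntry m k₀) (coreStep k₀ L fun c => (L c)⁻¹) := by
  have : Fact (1 < m) := ⟨by omega⟩
  have L0 : ∀ x, L k₀ x = x := fun x => by rw [h1]; rfl
  have L0' : ∀ x, (L k₀)⁻¹ x = x := fun x => by rw [h1]; rfl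
  rintro (_ | c)
  · have hr := Relation.EqvGen.is_equivalence
      (fun a b => ∃ p, a = .inl p ∧ b = coreStep k₀ L (fun c => (L c)⁻¹) none p)
    have all := coreStep_none_rel (L := L) (M := fun c => (L c)⁻¹) (k₀ := k₀) hr Sum.inl
      fun p q h => .rel _ _ ⟨p, rfl, h.symm⟩
    refine ⟨?_, fun p => ⟨1, rfl, hr.trans (all p) (hr.symm (all _))⟩⟩
    rintro x rfl
    exact hr.trans (all _) (.rel _ _ ⟨(true, 1), rfl, by simp [coreStep]⟩)
  · have hr := Relation.EqvGen.is_equivalence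
      (fun a b => ∃ p, a = .inl p ∧ b = coreStep k₀ L (fun c => (L c)⁻¹) (some c) p)
    by_cases hc : c = k₀
    · subst hc
      have a1 : Relation.EqvGen
          (fun a b => ∃ p, a = .inl p ∧ b = coreStep c L (fun c => (L c)⁻¹) (some c) p)
          (.inl (false, 0)) (.inl (false, 1)) := .rel _ _ ⟨(false, 0), rfl, by simp [coreStep]⟩
      have a2 : ∀ x, x ≠ 0 → Relation.EqvGen
          (fun a b => ∃ p, a = .inl p ∧ b = coreStep c L (fun c => (L c)⁻¹) (some c) p)
          (.inl (false, x)) (.inl (true, x)) := fun x hx =>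
        .rel _ _ ⟨(false, x), rfl, by simp [coreStep, hx, L0]⟩
      have a3 : Relation.EqvGen
          (fun a b => ∃ p, a = .inl p ∧ b = coreStep c L (fun c => (L c)⁻¹) (some c) p)
          (.inl (true, 1)) (.inl (true, 0)) := .rel _ _ ⟨(true, 1), rfl, by simp [coreStep]⟩
      have a4 : ∀ x, x ≠ 1 → Relation.EqvGen
          (fun a b => ∃ p, a = .inl p ∧ b = coreStep c L (fun c => (L c)⁻¹) (some c) p)
          (.inl (true, x)) (.inr x) := fun x hx =>
        .rel _ _ ⟨(true, x), rfl, by simp [coreStep, hx, L0']⟩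
      have b1 := hr.trans a1 (a2 1 one_ne_zero)
      have b2 := hr.trans b1 a3
      refine ⟨fun x hx => ?_, ?_⟩
      · have hx1 : x ≠ 1 := hx rfl
        by_cases hx0 : x = 0
        · subst hx0
          exact hr.trans b2 (a4 0 hx1)
        · exact hr.trans (a2 x hx0) (a4 x hx1)
      · rintro ⟨_ | _, x⟩
        · by_cases hx : x = 1
          · subst hx
            exact ⟨0, fun _ => zero_ne_one, hr.symm a1⟩
          · exact ⟨x, fun _ => hx, hr.refl _⟩
        · by_cases hx : x = 1
          · subst hx
            exact ⟨0, fun _ => zero_ne_one, hr.symm b1⟩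
          · refine ⟨x, fun _ => hx, ?_⟩
            by_cases hx0 : x = 0
            · subst hx0
              exact hr.symm b2
            · exact hr.symm (a2 x hx0)
    · have a1 : ∀ x, Relation.EqvGen
          (fun a b => ∃ p, a = .inl p ∧ b = coreStep k₀ L (fun c => (L c)⁻¹) (some c) p)
          (.inl (false, x)) (.inl (true, L c x)) := fun x =>
        .rel _ _ ⟨(false, x), rfl, by simp [coreStep, hc]⟩
      refine ⟨fun x _ => hr.trans (a1 x)
        (.rel _ _ ⟨(true, L c x), rfl, by simp [coreStep, hc]⟩), ?_⟩
      rintro ⟨_ | _, x⟩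
      · exact ⟨x, fun h => (hc h).elim, hr.refl _⟩
      · refine ⟨(L c)⁻¹ x, fun h => (hc h).elim, ?_⟩
        have := a1 ((L c)⁻¹ x)
        rw [← Equiv.Perm.mul_apply, mul_inv_cancel, Equiv.Perm.one_apply] at this
        exact hr.symm this

/-- When the block closes up, the colour `some c` follows `L' c * L c`. The colour `some k₀` follows
`L' k₀` on the points other than `1`, and visits the two vertices labelled `1` on its way from `0`
to `L' k₀ 0`. -/
theorem isLoop_coreStep [NeZero m] (hm : 2 ≤ m) (h : IsLatinCore k₀ 1 L M) :
    IsLoop (coreStep k₀ L M) := by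
  have : Fact (1 < m) := ⟨by omega⟩
  have L0 : ∀ x, L k₀ x = x := fun x => by rw [h.eq_one]; rfl
  rintro (_ | c) p q
  · have hr := Relation.EqvGen.is_equivalence
      (fun a b => Sum.elim id (fun y => (false, y)) (coreStep k₀ L M none a) = b)
    have all := coreStep_none_rel (L := L) (M := M) (k₀ := k₀) hr id
      fun p q h => .rel _ _ (by simp [h])
    exact hr.trans (all p) (hr.symm (all q))
  · have hr := Relation.EqvGen.is_equivalence
      (fun a b => Sum.elim id (fun y => (false, y)) (coreStep k₀ L M (some c) a) = b)
    by_cases hc : c = k₀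
    · subst hc
      have a1 : Relation.EqvGen
          (fun a b => Sum.elim id (fun y => (false, y)) (coreStep c L M (some c) a) = b)
          (false, 0) (false, 1) := .rel _ _ (by simp [coreStep])
      have a2 : ∀ x, x ≠ 0 → Relation.EqvGen
          (fun a b => Sum.elim id (fun y => (false, y)) (coreStep c L M (some c) a) = b)
          (false, x) (true, x) := fun x hx => .rel _ _ (by simp [coreStep, hx, L0])
      have a3 : Relation.EqvGen
          (fun a b => Sum.elim id (fun y => (false, y)) (coreStep c L M (some c) a) = b)
          (true, 1) (true, 0) := .rel _ _ (by simp [coreStep])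
      have a4 : ∀ x, x ≠ 1 → Relation.EqvGen
          (fun a b => Sum.elim id (fun y => (false, y)) (coreStep c L M (some c) a) = b)
          (true, x) (false, M c x) := fun x hx => .rel _ _ (by simp [coreStep, hx])
      have b1 := hr.trans a1 (a2 1 one_ne_zero)
      have b2 := hr.trans b1 a3
      have next : ∀ x, Relation.EqvGen
          (fun a b => Sum.elim id (fun y => (false, y)) (coreStep c L M (some c) a) = b)
          (false, x) (false, M c x) := by
        intro x
        by_cases hx1 : x = 1
        · rw [hx1, h.fixed]
          exact hr.refl _
        · by_cases hx0 : x = 0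
          · subst hx0
            exact hr.trans b2 (a4 0 hx1)
          · exact hr.trans (a2 x hx0) (a4 x hx1)
      have all : ∀ p, Relation.EqvGen
          (fun a b => Sum.elim id (fun y => (false, y)) (coreStep c L M (some c) a) = b)
          p (false, 0) := by
        have first : ∀ x, Relation.EqvGen
            (fun a b => Sum.elim id (fun y => (false, y)) (coreStep c L M (some c) a) = b)
            (false, x) (false, 0) := by
          intro x
          by_cases hx : x = 1
          · subst hx
            exact hr.symm a1
          · exact (h.sameCycle x 0 hx zero_ne_one).rel (hr.comap fun x => (false, x)) next
        rintro ⟨_ | _, x⟩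
        · exact first x
        · by_cases hx0 : x = 0
          · subst hx0
            exact hr.symm b2
          · exact hr.trans (hr.symm (a2 x hx0)) (first x)
      exact hr.trans (all p) (hr.symm (all q))
    · have a1 : ∀ x, Relation.EqvGen
          (fun a b => Sum.elim id (fun y => (false, y)) (coreStep k₀ L M (some c) a) = b)
          (false, x) (true, L c x) := fun x => .rel _ _ (by simp [coreStep, hc])
      have first : ∀ x y, Relation.EqvGen
          (fun a b => Sum.elim id (fun y => (false, y)) (coreStep k₀ L M (some c) a) = b)
          (false, x) (false, y) := fun x y =>
        (h.sameCycle_mul c hc x y).rel (hr.comap fun x => (false, x)) fun x =>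
          hr.trans (a1 x) (.rel _ _ (by simp [coreStep, hc]))
      have all : ∀ p, Relation.EqvGen
          (fun a b => Sum.elim id (fun y => (false, y)) (coreStep k₀ L M (some c) a) = b)
          p (false, 0) := by
        rintro ⟨_ | _, x⟩
        · exact first x 0
        · have := a1 ((L c)⁻¹ x)
          rw [← Equiv.Perm.mul_apply, mul_inv_cancel, Equiv.Perm.one_apply] at this
          exact hr.trans (hr.symm this) (first _ 0)
      exact hr.trans (all p) (hr.symm (all q))

end CoreStep

/-- There is a pair of block types that decompose all arcs, including those within the layers, as
`Digraph.layered_isPermDecomposition` requires. -/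
def HasBlocks (m : ℕ) : Prop :=
  ∃ (K : Type) (_ : Nonempty K) (E : K → Set (ZMod m))
    (s s' : K → Bool × ZMod m → (Bool × ZMod m) ⊕ ZMod m),
    IsBlock True E s ∧ IsBlock True E s' ∧ IsLoop s ∧ IsPassThrough E s'

theorem IsLatinCore.hasBlocks {X K : Type} [Fintype X] {m : ℕ} [NeZero m] (hm : 2 ≤ m)
    (hX : Fintype.card X = m) {k₀ : K} {v : X} {L L' : K → Equiv.Perm X}
    (h : IsLatinCore k₀ v L L') : HasBlocks m := by
  obtain ⟨e, he⟩ : ∃ e : X ≃ ZMod m, e v = 1 := by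
    classical
    have e := Fintype.equivOfCardEq (hX.trans (ZMod.card m).symm)
    exact ⟨e.trans (Equiv.swap (e v) 1), by simp⟩
  have h2 := h.permCongr e
  rw [he] at h2
  have hinv : ∀ x y, ∃! c, (e.permCongr (L c))⁻¹ x = y := fun x y => by
    simp only [Equiv.Perm.inv_eq_iff_eq, @eq_comm _ x]
    exact h2.latin y x
  exact ⟨Option K, inferInstance, coreEntry m k₀, coreStep k₀ _ _, coreStep k₀ _ _,
    isBlock_coreStep h2.latin h2.latin' h2.eq_one h2.fixed,
    isBlock_coreStep h2.latin hinv h2.eq_one (by rw [h2.eq_one]; rfl),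
    isLoop_coreStep hm h2, isPassThrough_coreStep hm h2.eq_one⟩

/-! ### Latin squares from translates of a permutation -/

/-- The permutation `θ`, changed so that the new point `none` is inserted between `a` and `θ a`. -/
def Equiv.Perm.insertNone {X : Type*} [DecidableEq X] (θ : Equiv.Perm X) (a : X) :
    Equiv.Perm (Option X) :=
  Equiv.optionCongr θ * Equiv.swap none (some a)

section InsertNone

variable {X : Type*} [DecidableEq X] (θ : Equiv.Perm X) (a : X)

@[simp]
theorem Equiv.Perm.insertNone_none : θ.insertNone a none = some (θ a) := by
  simp [insertNone]

@[simp]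
theorem Equiv.Perm.insertNone_some_self : θ.insertNone a (some a) = none := by
  simp [insertNone]

theorem Equiv.Perm.insertNone_some_of_ne {x : X} (h : x ≠ a) :
    θ.insertNone a (some x) = some (θ x) := by
  rw [insertNone, Equiv.Perm.mul_apply, Equiv.swap_apply_of_ne_of_ne (by simp) (by simpa using h)]
  simp

end InsertNone

section Starter

variable {q : ℕ}

/-- The translates of the permutation `θ.insertNone a` by the elements of `ZMod q`, and the
translation by `s`, all with `none` as a point at infinity. -/
def translates (θ : Equiv.Perm (ZMod q)) (a s : ZMod q) :
    Option (ZMod q) → Equiv.Perm (Option (ZMod q))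
  | none => Equiv.optionCongr (Equiv.addRight s)
  | some c => Equiv.optionCongr (Equiv.addRight c) * θ.insertNone a *
      (Equiv.optionCongr (Equiv.addRight c))⁻¹

variable {θ θ' : Equiv.Perm (ZMod q)} {a a' s : ZMod q}

theorem translates_none_none : translates θ a s none none = none := rfl

theorem translates_some_none (c : ZMod q) : translates θ a s (some c) none = some (θ a + c) := by
  have : (Equiv.optionCongr (Equiv.addRight c))⁻¹ (none : Option (ZMod q)) = none := by
    rw [Equiv.Perm.inv_eq_iff_eq]
    rfl
  simp only [translates, Equiv.Perm.mul_apply, this, Equiv.Perm.insertNone_none]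
  rfl

theorem translates_some_some (c x : ZMod q) : translates θ a s (some c) (some x) =
    if x - c = a then none else some (θ (x - c) + c) := by
  have : (Equiv.optionCongr (Equiv.addRight c))⁻¹ (some x) = some (x - c) := by
    rw [Equiv.Perm.inv_eq_iff_eq]
    simp
  simp only [translates, Equiv.Perm.mul_apply, this]
  split_ifs with h
  · rw [h, Equiv.Perm.insertNone_some_self]
    rfl
  · rw [Equiv.Perm.insertNone_some_of_ne _ _ h]
    rfl

theorem existsUnique_translates [NeZero q]
    (hθ : ∀ x y, x ≠ a → y ≠ a → θ x - x = θ y - y → x = y) (hs : ∀ x ≠ a, θ x - x ≠ s)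
    (x y : Option (ZMod q)) : ∃! c, translates θ a s c x = y := by
  suffices h : Function.Injective fun c => translates θ a s c x from
    (Finite.injective_iff_bijective.1 h).existsUnique y
  have key : ∀ x c : ZMod q, θ (x - c) + c = x + (θ (x - c) - (x - c)) := fun x c => by ring
  intro c c' h
  obtain _ | x := x
  · obtain _ | c := c <;> obtain _ | c' := c'
    · rfl
    · simp only [translates_some_none, translates_none_none, reduceCtorEq] at h
    · simp only [translates_some_none, translates_none_none, reduceCtorEq] at h
    · simpa [translates_some_none] using h
  · have main : ∀ c, translates θ a s none (some x) ≠ translates θ a s (some c) (some x) := by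
      intro c h
      simp only [translates_some_some] at h
      split_ifs at h with h1
      · simp [translates] at h
      · have : x + s = θ (x - c) + c := by simpa [translates] using h
        rw [key, add_right_inj] at this
        exact hs _ h1 this.symm
    obtain _ | c := c <;> obtain _ | c' := c'
    · rfl
    · exact (main _ h).elim
    · exact (main _ h.symm).elim
    · simp only [translates_some_some] at h
      split_ifs at h with h1 h2 h2
      · rw [← h2, sub_right_inj] at h1
        rw [h1]
      · simp only [Option.some.injEq, key, add_right_inj] at h
        have := hθ _ _ h1 h2 h
        rw [sub_right_inj] at this
        rw [this]

/-- Two permutations of `ZMod q` whose displacements are distinct, apart from one point each, give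
two Latin squares of order `q + 1` by translation. -/
theorem isLatinCore_translates [NeZero q]
    (hθ : ∀ x y, x ≠ a → y ≠ a → θ x - x = θ y - y → x = y) (h0 : ∀ x ≠ a, θ x - x ≠ 0)
    (hθ' : ∀ x y, x ≠ a' → y ≠ a' → θ' x - x = θ' y - y → x = y) (hs : ∀ x ≠ a', θ' x - x ≠ s)
    (hu : IsUnit s) (h : ∀ x y, (θ'.insertNone a' * θ.insertNone a).SameCycle x y) :
    IsLatinCore none none (translates θ a 0) (translates θ' a' s) where
  latin := existsUnique_translates hθ h0
  latin' := existsUnique_translates hθ' hs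
  eq_one := by
    ext x : 1
    cases x <;> simp [translates]
  fixed := by simp [translates]
  sameCycle x y hx hy := by
    obtain ⟨x, rfl⟩ := Option.ne_none_iff_exists'.1 hx
    obtain ⟨y, rfl⟩ := Option.ne_none_iff_exists'.1 hy
    have hn : ∀ n : ℕ, (translates θ' a' s none ^ n) (some x) = some (x + n * s) := by
      intro n
      induction n with
      | zero => simp
      | succ n ih =>
        rw [pow_succ', Equiv.Perm.mul_apply, ih]
        simp only [translates, Equiv.optionCongr_apply, Option.map_some, Equiv.coe_addRight]
        push_cast
        ring_nf
    obtain ⟨u, rfl⟩ := hu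
    refine ⟨((y - x) * ↑u⁻¹ : ZMod q).val, ?_⟩
    rw [zpow_natCast, hn, ZMod.natCast_zmod_val, mul_assoc, Units.inv_mul, mul_one,
      add_sub_cancel]
  sameCycle_mul c hc x y := by
    obtain ⟨c, rfl⟩ := Option.ne_none_iff_exists'.1 hc
    have : translates θ' a' s (some c) * translates θ a 0 (some c) =
        Equiv.optionCongr (Equiv.addRight c) * (θ'.insertNone a' * θ.insertNone a) *
          (Equiv.optionCongr (Equiv.addRight c))⁻¹ := by
      simp only [translates]
      group
    rw [this, Equiv.Perm.sameCycle_conj]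
    exact h _ _

/-- For odd `q`, a complete mapping `σ` of `ZMod q` that fixes `0` and is transitive on the other
elements gives blocks for `q + 1`. With `-σ` as first and negation as second permutation, the
composite is `σ`, except that `none` and `0` are inserted before `1`. -/
theorem hasBlocks_of_odd [NeZero q] (hq : 3 ≤ q) (hodd : Odd q) (σ : Equiv.Perm (ZMod q))
    (h0 : σ 0 = 0) (hinj : ∀ x y, x + σ x = y + σ y → x = y)
    (hcyc : ∀ x y, x ≠ 0 → y ≠ 0 → σ.SameCycle x y) : HasBlocks (q + 1) := by
  have : Fact (1 < q) := ⟨by omega⟩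
  have h2 : IsUnit (2 : ZMod q) := by
    have := (ZMod.isUnit_iff_coprime 2 q).2 (Nat.coprime_two_left.2 hodd)
    exact_mod_cast this
  have h10 : (1 : ZMod q) ≠ 0 := one_ne_zero
  refine (isLatinCore_translates (θ := σ.trans (Equiv.neg _)) (θ' := Equiv.neg _) (a := 0)
    (a' := -1) (s := 2) ?_ ?_ ?_ ?_ h2 ?_).hasBlocks (by omega) (by simp)
  · intro x y _ _ h
    refine hinj x y (neg_injective ?_)
    simp only [Equiv.trans_apply, Equiv.neg_apply] at h
    linear_combination h
  · intro x hx h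
    refine hx (hinj x 0 ?_)
    simp only [Equiv.trans_apply, Equiv.neg_apply] at h
    rw [h0]
    linear_combination -h
  · intro x y _ _ h
    refine h2.mul_left_cancel ?_
    simp only [Equiv.neg_apply] at h
    linear_combination -h
  · intro x hx h
    refine hx (h2.mul_left_cancel ?_)
    simp only [Equiv.neg_apply] at h
    linear_combination -h
  · set F := (Equiv.Perm.insertNone (Equiv.neg (ZMod q)) (-1)) *
      Equiv.Perm.insertNone (σ.trans (Equiv.neg _)) 0 with hF
    have step : ∀ u w, F u = w → F.SameCycle u w := by
      rintro u _ rfl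
      exact Equiv.Perm.sameCycle_apply_right.2 (Equiv.Perm.SameCycle.refl _ _)
    have e1 : F none = some 0 := by
      rw [hF, Equiv.Perm.mul_apply, Equiv.Perm.insertNone_none, Equiv.Perm.insertNone_some_of_ne]
      · simp [h0]
      · simp [h0]
    have e2 : F (some 0) = some 1 := by
      rw [hF, Equiv.Perm.mul_apply, Equiv.Perm.insertNone_some_self, Equiv.Perm.insertNone_none]
      simp
    have e3 : ∀ x, F.SameCycle (some x) (some (σ x)) := by
      intro x
      by_cases hx : x = 0
      · rw [hx, h0]
      · have e4 : F (some x) = Equiv.Perm.insertNone (Equiv.neg (ZMod q)) (-1) (some (-σ x)) := by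
          rw [hF, Equiv.Perm.mul_apply, Equiv.Perm.insertNone_some_of_ne _ _ hx]
          rfl
        by_cases h1 : σ x = 1
        · rw [h1, Equiv.Perm.insertNone_some_self] at e4
          rw [h1]
          exact (step _ _ e4).trans ((step _ _ e1).trans (step _ _ e2))
        · rw [Equiv.Perm.insertNone_some_of_ne _ _ (by simpa using h1)] at e4
          exact step _ _ (by simpa using e4)
    have all : ∀ x, F.SameCycle x (some 1) := by
      rintro (_ | x)
      · exact (step _ _ e1).trans (step _ _ e2)
      · by_cases hx : x = 0
        · rw [hx]
          exact step _ _ e2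
        · exact (hcyc x 1 hx h10).rel
            (r := fun x y => F.SameCycle (some x) (some y))
            ⟨fun _ => .refl _ _, fun h => h.symm, fun h h' => h.trans h'⟩ e3
    exact fun x y => (all x).trans (all y).symm

/-- A permutation `φ` of `ZMod q` with displacements distinct apart from one point gives blocks for
`q + 1`. The second permutation is chosen so that the composite is the translation by `1`, with the
point at infinity inserted after `0`. -/
theorem hasBlocks_of_perm [NeZero q] (hq : 1 ≤ q) (φ : Equiv.Perm (ZMod q)) {a : ZMod q}
    (ha : a ≠ 0) (hφ : φ a = 0) (hinj : ∀ x y, x ≠ a → y ≠ a → φ x - x = φ y - y → x = y)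
    (hne : ∀ x ≠ a, φ x - x ≠ 0) (hu : IsUnit (1 - φ 0)) : HasBlocks (q + 1) := by
  -- up to the exchange of `0` and `a`, this is `φ⁻¹` followed by the translation by `1`
  let θ' : Equiv.Perm (ZMod q) := Equiv.addRight 1 * Equiv.swap 0 a * φ⁻¹
  have t0 : θ' (φ 0) = a + 1 := by simp [θ']
  have ta : θ' (φ a) = 1 := by simp [θ']
  have tx : ∀ x, x ≠ 0 → x ≠ a → θ' (φ x) = x + 1 := fun x h1 h2 => by
    simp [θ', Equiv.swap_apply_of_ne_of_ne h1 h2]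
  have h00 : φ 0 ≠ 0 := fun h => ha (φ.injective (hφ.trans h.symm))
  have tsub : ∀ x, x ≠ 0 → x ≠ a → θ' (φ x) - φ x = 1 - (φ x - x) := fun x h1 h2 => by
    rw [tx x h1 h2]
    ring
  have tsuba : θ' (φ a) - φ a = 1 := by rw [ta, hφ, sub_zero]
  refine (isLatinCore_translates (θ := φ) (θ' := θ') (a := a) (a' := φ 0) (s := 1 - φ 0) hinj hne
    ?_ ?_ hu ?_).hasBlocks (by omega) (by simp)
  · intro x y hx hy h
    obtain ⟨x, rfl⟩ := φ.surjective x
    obtain ⟨y, rfl⟩ := φ.surjective y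
    have hx0 : x ≠ 0 := fun h => hx (by rw [h])
    have hy0 : y ≠ 0 := fun h => hy (by rw [h])
    by_cases hxa : x = a <;> by_cases hya : y = a
    · rw [hxa, hya]
    · rw [hxa, tsuba, tsub y hy0 hya] at h
      exact (hne y hya (by linear_combination h)).elim
    · rw [hya, tsuba, tsub x hx0 hxa] at h
      exact (hne x hxa (by linear_combination -h)).elim
    · rw [tsub x hx0 hxa, tsub y hy0 hya, sub_right_inj] at h
      rw [hinj x y hxa hya h]
  · intro x hx h
    obtain ⟨x, rfl⟩ := φ.surjective x
    have hx0 : x ≠ 0 := fun h => hx (by rw [h])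
    by_cases hxa : x = a
    · rw [hxa, tsuba] at h
      exact h00 (by linear_combination h)
    · rw [tsub x hx0 hxa] at h
      exact hx0 (hinj x 0 hxa ha.symm (by linear_combination -h))
  · set F := θ'.insertNone (φ 0) * φ.insertNone a with hF
    have step : ∀ u w, F u = w → F.SameCycle u w := by
      rintro u _ rfl
      exact Equiv.Perm.sameCycle_apply_right.2 (Equiv.Perm.SameCycle.refl _ _)
    have e1 : F none = some 1 := by
      rw [hF, Equiv.Perm.mul_apply, Equiv.Perm.insertNone_none,
        Equiv.Perm.insertNone_some_of_ne _ _ (by rw [hφ]; exact h00.symm), ta]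
    have e2 : F (some 0) = none := by
      rw [hF, Equiv.Perm.mul_apply, Equiv.Perm.insertNone_some_of_ne _ _ ha.symm,
        Equiv.Perm.insertNone_some_self]
    have e3 : ∀ x, F.SameCycle (some x) (some (x + 1)) := by
      intro x
      by_cases hx : x = 0
      · rw [hx, zero_add]
        exact (step _ _ e2).trans (step _ _ e1)
      · refine step _ _ ?_
        by_cases hxa : x = a
        · rw [hF, Equiv.Perm.mul_apply, hxa, Equiv.Perm.insertNone_some_self,
            Equiv.Perm.insertNone_none, t0]
        · rw [hF, Equiv.Perm.mul_apply, Equiv.Perm.insertNone_some_of_ne _ _ hxa,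
            Equiv.Perm.insertNone_some_of_ne _ _ (fun h => hx (φ.injective h)), tx x hx hxa]
    -- the composite runs through `0, none, 1, 2, …`
    have e4 : ∀ n : ℕ, F.SameCycle (some 0) (some (n : ZMod q)) := by
      intro n
      induction n with
      | zero => rw [Nat.cast_zero]
      | succ n ih => exact ih.trans (by simpa using e3 n)
    have all : ∀ x, F.SameCycle (some 0) x := by
      rintro (_ | x)
      · exact step _ _ e2
      · simpa using e4 x.val
    exact fun x y => (all x).symm.trans (all y)

end Starter

/-- A function that permutes the natural numbers below `q`, as a permutation of `ZMod q`. -/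
noncomputable def permOfNat (q : ℕ) [NeZero q] (s : ℕ → ℕ) (hs : ∀ x < q, s x < q)
    (hinj : ∀ x < q, ∀ y < q, s x = s y → x = y) : Equiv.Perm (ZMod q) :=
  Equiv.ofBijective (fun x => (s x.val : ZMod q)) (Finite.injective_iff_bijective.1 fun x y h => by
    have h' := congrArg ZMod.val h
    rw [ZMod.val_natCast_of_lt (hs _ (ZMod.val_lt x)),
      ZMod.val_natCast_of_lt (hs _ (ZMod.val_lt y))] at h'
    exact ZMod.val_injective q (hinj _ (ZMod.val_lt x) _ (ZMod.val_lt y) h'))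

theorem permOfNat_natCast {q : ℕ} [NeZero q] {s : ℕ → ℕ} (hs : ∀ x < q, s x < q)
    (hinj : ∀ x < q, ∀ y < q, s x = s y → x = y) {x : ℕ} (hx : x < q) :
    permOfNat q s hs hinj (x : ZMod q) = s x := by
  simp [permOfNat, ZMod.val_natCast_of_lt hx]

/-- Natural numbers below `2 * q` are congruent modulo `q` if they are equal or differ by `q`. -/
theorem ZMod.natCast_eq_natCast_of_lt {q a b : ℕ} (ha : a < 2 * q) (hb : b < 2 * q)
    (h : (a : ZMod q) = b) : a = b ∨ a = b + q ∨ b = a + q := by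
  obtain ⟨c, hc⟩ := (ZMod.intCast_eq_intCast_iff_dvd_sub a b q).1 (by exact_mod_cast h)
  have h1 : c < 2 := by nlinarith
  have h2 : -2 < c := by nlinarith
  interval_cases c <;> omega

/-- `hasBlocks_of_odd` for a permutation given by a formula on the natural numbers below `q`. As
sums of two such numbers are less than `2 * q`, congruence leaves few cases. -/
theorem hasBlocks_of_odd_nat {q : ℕ} (hq : 3 ≤ q) (hodd : Odd q) (s : ℕ → ℕ)
    (hs : ∀ x < q, s x < q) (hinj : ∀ x < q, ∀ y < q, s x = s y → x = y) (h0 : s 0 = 0)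
    (hsum : ∀ x < q, ∀ y < q, x + s x = y + s y ∨ x + s x = y + s y + q → x = y)
    (hcyc : ∀ r : ℕ → ℕ → Prop, Equivalence r → (∀ x, 1 ≤ x → x < q → r x (s x)) →
      ∀ x, 1 ≤ x → x < q → r 1 x) : HasBlocks (q + 1) := by
  have : NeZero q := ⟨by omega⟩
  have lift : ∀ x : ZMod q, ∃ n < q, x = n := fun x => ⟨x.val, ZMod.val_lt x, by simp⟩
  refine hasBlocks_of_odd hq hodd (permOfNat q s hs hinj) ?_ ?_ ?_
  · have := permOfNat_natCast hs hinj (x := 0) (by omega)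
    rwa [h0, Nat.cast_zero] at this
  · intro x y h
    obtain ⟨x, hx, rfl⟩ := lift x
    obtain ⟨y, hy, rfl⟩ := lift y
    rw [permOfNat_natCast hs hinj hx, permOfNat_natCast hs hinj hy] at h
    have hsx := hs x hx
    have hsy := hs y hy
    rcases ZMod.natCast_eq_natCast_of_lt (q := q) (a := x + s x) (b := y + s y) (by omega)
      (by omega) (by exact_mod_cast h) with h | h | h
    · rw [hsum x hx y hy (.inl h)]
    · rw [hsum x hx y hy (.inr h)]
    · rw [hsum y hy x hx (.inr h)]
  · have all : ∀ x : ZMod q, x ≠ 0 → (permOfNat q s hs hinj).SameCycle 1 x := by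
      intro x hx
      obtain ⟨x, hxq, rfl⟩ := lift x
      have := hcyc (fun x y => (permOfNat q s hs hinj).SameCycle (x : ZMod q) (y : ZMod q))
        ⟨fun _ => .refl _ _, fun h => h.symm, fun h h' => h.trans h'⟩ (fun x _ hx => ?_) x
        (Nat.pos_of_ne_zero fun h => hx (by simp [h])) hxq
      · simpa using this
      · rw [← permOfNat_natCast hs hinj hx]
        exact Equiv.Perm.sameCycle_apply_right.2 (.refl _ _)
    exact fun x y hx hy => (all x hx).symm.trans (all y hy)

/-- `hasBlocks_of_perm` for a permutation given by a formula on the natural numbers below `q`, where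
`b` represents `1 - φ 0`. -/
theorem hasBlocks_of_perm_nat {q : ℕ} (hq : 1 ≤ q) (s : ℕ → ℕ) {a b : ℕ} (ha0 : 0 < a)
    (haq : a < q) (hs : ∀ x < q, s x < q) (hinj : ∀ x < q, ∀ y < q, s x = s y → x = y)
    (ha : s a = 0)
    (hsub : ∀ x < q, ∀ y < q, x ≠ a → y ≠ a →
      s x + y = s y + x ∨ s x + y = s y + x + q → x = y)
    (hne : ∀ x < q, x ≠ a → s x ≠ x) (hb : s 0 + b = q + 1) (hbq : Nat.Coprime b q) :
    HasBlocks (q + 1) := by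
  have : NeZero q := ⟨by omega⟩
  have lift : ∀ x : ZMod q, ∃ n < q, x = n := fun x => ⟨x.val, ZMod.val_lt x, by simp⟩
  refine hasBlocks_of_perm hq (permOfNat q s hs hinj) (a := a) ?_ ?_ ?_ ?_ ?_
  · rw [Ne, ZMod.natCast_eq_zero_iff]
    exact Nat.not_dvd_of_pos_of_lt ha0 haq
  · rw [permOfNat_natCast hs hinj haq, ha, Nat.cast_zero]
  · intro x y hxa hya h
    obtain ⟨x, hx, rfl⟩ := lift x
    obtain ⟨y, hy, rfl⟩ := lift y
    have hxa : x ≠ a := fun h => hxa (by rw [h])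
    have hya : y ≠ a := fun h => hya (by rw [h])
    rw [permOfNat_natCast hs hinj hx, permOfNat_natCast hs hinj hy] at h
    have hsx := hs x hx
    have hsy := hs y hy
    rcases ZMod.natCast_eq_natCast_of_lt (q := q) (a := s x + y) (b := s y + x) (by omega)
      (by omega) (by push_cast; linear_combination h) with h | h | h
    · rw [hsub x hx y hy hxa hya (.inl h)]
    · rw [hsub x hx y hy hxa hya (.inr h)]
    · rw [hsub y hy x hx hya hxa (.inr h)]
  · intro x hxa h
    obtain ⟨x, hx, rfl⟩ := lift x
    have hxa : x ≠ a := fun h => hxa (by rw [h])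
    rw [permOfNat_natCast hs hinj hx, sub_eq_zero] at h
    have := congrArg ZMod.val h
    rw [ZMod.val_natCast_of_lt (hs x hx), ZMod.val_natCast_of_lt hx] at this
    exact hne x hx hxa this
  · have h1 := permOfNat_natCast hs hinj (x := 0) (by omega)
    rw [Nat.cast_zero] at h1
    rw [h1, show (1 : ZMod q) - (s 0 : ℕ) = (b : ℕ) by
      have := congrArg (Nat.cast : ℕ → ZMod q) hb
      push_cast at this
      rw [ZMod.natCast_self, zero_add] at this
      linear_combination -this]
    exact (ZMod.isUnit_iff_coprime b q).2 hbq

/-! ### Permutations for all orders except `4` and `5` -/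

/-- A complete mapping of the integers modulo `4 * k + 1`, written on the representatives below
`4 * k + 1`, which fixes `0` and is transitive on the rest. -/
def sigmaOne (k x : ℕ) : ℕ :=
  if x = 0 then 0 else if x ≤ k then x + 2 * k else if x = k + 1 then k
  else if x ≤ 2 * k + 1 then x + 2 * k - 1 else if x ≤ 3 * k then x - 2 * k - 1 else x - 2 * k

theorem sigmaOne_cases (k x : ℕ) :
    (x = 0 ∧ sigmaOne k x = 0) ∨
    (1 ≤ x ∧ x ≤ k ∧ sigmaOne k x = x + 2 * k) ∨
    (x = k + 1 ∧ sigmaOne k x = k) ∨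
    (k + 2 ≤ x ∧ x ≤ 2 * k + 1 ∧ sigmaOne k x = x + 2 * k - 1) ∨
    (2 * k + 2 ≤ x ∧ x ≤ 3 * k ∧ sigmaOne k x = x - 2 * k - 1) ∨
    (3 * k + 1 ≤ x ∧ sigmaOne k x = x - 2 * k) := by
  unfold sigmaOne
  split_ifs <;>
    repeat first
      | exact ⟨by omega, rfl⟩
      | exact .inl ⟨by omega, rfl⟩
      | exact .inl ⟨by omega, by omega, rfl⟩
      | refine .inr ?_

theorem hasBlocks_four_mul_add_two {k : ℕ} (hk : 1 ≤ k) : HasBlocks (4 * k + 1 + 1) := by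
  refine hasBlocks_of_odd_nat (by omega) (by grind) (sigmaOne k) ?_ ?_ rfl ?_ ?_
  · intro x hx
    have := sigmaOne_cases k x
    omega
  · intro x hx y hy e
    have hsx := sigmaOne_cases k x
    have hsy := sigmaOne_cases k y
    generalize sigmaOne k x = sx at *
    generalize sigmaOne k y = sy at *
    rcases hsx with h1 | h1 | h1 | h1 | h1 | h1 <;>
      rcases hsy with h2 | h2 | h2 | h2 | h2 | h2 <;> omega
  · intro x hx y hy e
    have hsx := sigmaOne_cases k x
    have hsy := sigmaOne_cases k y
    generalize sigmaOne k x = sx at *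
    generalize sigmaOne k y = sy at *
    rcases hsx with h1 | h1 | h1 | h1 | h1 | h1 <;>
      rcases hsy with h2 | h2 | h2 | h2 | h2 | h2 <;> omega
  · intro r hr h
    have h' : ∀ x y, 1 ≤ x → x < 4 * k + 1 → sigmaOne k x = y → r x y :=
      fun x y h1 h2 h3 => h3 ▸ h x h1 h2
    -- `1, …, k` are connected by `x ↦ x + 2 * k ↦ x - 1`
    have a1 : ∀ x, 1 ≤ x → x ≤ k → r x (x + 2 * k) := fun x h1 h2 =>
      h' x (x + 2 * k) h1 (by omega) (by have := sigmaOne_cases k x; omega)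
    have a2 : ∀ x, 1 ≤ x → x ≤ k - 1 → r (x + 2 * k + 1) x := fun x h1 h2 =>
      h' (x + 2 * k + 1) x (by omega) (by omega)
        (by have := sigmaOne_cases k (x + 2 * k + 1); omega)
    have low : ∀ x, 1 ≤ x → x ≤ k → r 1 x := by
      intro x h1
      induction x, h1 using Nat.le_induction with
      | base => exact fun _ => hr.refl 1
      | succ x h1 ih =>
        intro h2
        refine hr.trans (ih (by omega)) (hr.symm (hr.trans (a1 _ (by omega) h2) ?_))
        have := a2 x h1 (by omega)
        rwa [show x + 1 + 2 * k = x + 2 * k + 1 by omega]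
    -- `3 * k + 1, …, 4 * k` are connected by `x ↦ x - 2 * k ↦ x - 1`
    have b1 : ∀ x, 1 ≤ x → x ≤ k → r (x + 3 * k) (x + k) := fun x h1 h2 =>
      h' (x + 3 * k) (x + k) (by omega) (by omega)
        (by have := sigmaOne_cases k (x + 3 * k); omega)
    have b2 : ∀ x, 1 ≤ x → x ≤ k - 1 → r (x + k + 1) (x + 3 * k) := fun x h1 h2 =>
      h' (x + k + 1) (x + 3 * k) (by omega) (by omega)
        (by have := sigmaOne_cases k (x + k + 1); omega)
    have c1 : r (k + 1) k :=
      h' (k + 1) k (by omega) (by omega)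
        (by have := sigmaOne_cases k (k + 1); omega)
    have high : ∀ x, 1 ≤ x → x ≤ k → r 1 (x + 3 * k) := by
      intro x h1
      induction x, h1 using Nat.le_induction with
      | base =>
        intro _
        refine hr.trans (low k hk le_rfl) (hr.symm (hr.trans (b1 1 le_rfl hk) ?_))
        rwa [add_comm]
      | succ x h1 ih =>
        intro h2
        refine hr.trans (ih (by omega)) (hr.symm (hr.trans (b1 _ (by omega) h2) ?_))
        have := b2 x h1 (by omega)
        rwa [show x + 1 + k = x + k + 1 by omega]
    intro x hx1 hx2
    rcases le_or_gt x k with h1 | h1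
    · exact low x hx1 h1
    rcases le_or_gt x (2 * k) with h2 | h2
    · have := b1 (x - k) (by omega) (by omega)
      rw [show x - k + k = x by omega] at this
      exact hr.trans (high _ (by omega) (by omega)) this
    rcases le_or_gt x (3 * k) with h3 | h3
    · have := a1 (x - 2 * k) (by omega) (by omega)
      rw [show x - 2 * k + 2 * k = x by omega] at this
      exact hr.trans (low _ (by omega) (by omega)) this
    · have := high (x - 3 * k) (by omega) (by omega)
      rwa [show x - 3 * k + 3 * k = x by omega] at this

/-- A complete mapping of the integers modulo `4 * h + 3`, written on the representatives below
`4 * h + 3`, which fixes `0` and is transitive on the rest. -/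
def sigmaThree (h x : ℕ) : ℕ :=
  if x = 0 then 0 else if x ≤ h - 1 then x + 2 * h + 3 else if x = h then h + 2
  else if x = h + 1 then 3 * h + 3 else if x = h + 2 then h + 1
  else if x ≤ 2 * h + 1 then x + 2 * h + 1 else if x = 2 * h + 2 then 2 * h + 3
  else if x ≤ 3 * h + 2 then x - 2 * h - 2 else if x ≤ 4 * h + 1 then x - 2 * h else 2 * h + 2

theorem sigmaThree_cases {h : ℕ} (hh : 1 ≤ h) (x : ℕ) :
    (x = 0 ∧ sigmaThree h x = 0) ∨
    (1 ≤ x ∧ x ≤ h - 1 ∧ sigmaThree h x = x + 2 * h + 3) ∨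
    (x = h ∧ sigmaThree h x = h + 2) ∨
    (x = h + 1 ∧ sigmaThree h x = 3 * h + 3) ∨
    (x = h + 2 ∧ sigmaThree h x = h + 1) ∨
    (h + 3 ≤ x ∧ x ≤ 2 * h + 1 ∧ sigmaThree h x = x + 2 * h + 1) ∨
    (x = 2 * h + 2 ∧ sigmaThree h x = 2 * h + 3) ∨
    (2 * h + 3 ≤ x ∧ x ≤ 3 * h + 2 ∧ sigmaThree h x = x - 2 * h - 2) ∨
    (3 * h + 3 ≤ x ∧ x ≤ 4 * h + 1 ∧ sigmaThree h x = x - 2 * h) ∨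
    (4 * h + 2 ≤ x ∧ sigmaThree h x = 2 * h + 2) := by
  unfold sigmaThree
  split_ifs <;>
    repeat first
      | exact ⟨by omega, rfl⟩
      | exact .inl ⟨by omega, rfl⟩
      | exact .inl ⟨by omega, by omega, rfl⟩
      | refine .inr ?_

theorem hasBlocks_four_mul_add_four {h : ℕ} (hh : 1 ≤ h) : HasBlocks (4 * h + 3 + 1) := by
  refine hasBlocks_of_odd_nat (by omega) (by grind) (sigmaThree h) ?_ ?_ rfl ?_ ?_
  · intro x hx
    have := sigmaThree_cases hh x
    omega
  · intro x hx y hy e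
    have hsx := sigmaThree_cases hh x
    have hsy := sigmaThree_cases hh y
    generalize sigmaThree h x = sx at *
    generalize sigmaThree h y = sy at *
    rcases hsx with h1 | h1 | h1 | h1 | h1 | h1 | h1 | h1 | h1 | h1 <;>
      rcases hsy with h2 | h2 | h2 | h2 | h2 | h2 | h2 | h2 | h2 | h2 <;> omega
  · intro x hx y hy e
    have hsx := sigmaThree_cases hh x
    have hsy := sigmaThree_cases hh y
    generalize sigmaThree h x = sx at *
    generalize sigmaThree h y = sy at *
    rcases hsx with h1 | h1 | h1 | h1 | h1 | h1 | h1 | h1 | h1 | h1 <;>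
      rcases hsy with h2 | h2 | h2 | h2 | h2 | h2 | h2 | h2 | h2 | h2 <;> omega
  · intro r hr hs
    have h' : ∀ x y, 1 ≤ x → x < 4 * h + 3 → sigmaThree h x = y → r x y :=
      fun x y h1 h2 h3 => h3 ▸ hs x h1 h2
    -- `1, …, h` are connected by `x ↦ x + 2 * h + 3 ↦ x + 1`
    have a1 : ∀ x, 1 ≤ x → x ≤ h - 1 → r x (x + 2 * h + 3) := fun x h1 h2 =>
      h' x (x + 2 * h + 3) h1 (by omega) (by have := sigmaThree_cases hh x; omega)
    have a2 : ∀ x, 1 ≤ x → x ≤ h - 1 → r (x + 2 * h + 3) (x + 1) := fun x h1 h2 =>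
      h' (x + 2 * h + 3) (x + 1) (by omega) (by omega)
        (by have := sigmaThree_cases hh (x + 2 * h + 3); omega)
    have low : ∀ x, 1 ≤ x → x ≤ h → r 1 x := by
      intro x h1
      induction x, h1 using Nat.le_induction with
      | base => exact fun _ => hr.refl 1
      | succ x h1 ih =>
        intro h2
        exact hr.trans (ih (by omega)) (hr.trans (a1 x h1 (by omega)) (a2 x h1 (by omega)))
    have m1 : r h (h + 2) :=
      h' h (h + 2) (by omega) (by omega) (by have := sigmaThree_cases hh h; omega)
    have m2 : r (h + 2) (h + 1) :=
      h' (h + 2) (h + 1) (by omega) (by omega)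
        (by have := sigmaThree_cases hh (h + 2); omega)
    have m3 : r (h + 1) (3 * h + 3) :=
      h' (h + 1) (3 * h + 3) (by omega) (by omega)
        (by have := sigmaThree_cases hh (h + 1); omega)
    have e0 : r 1 (h + 2) := hr.trans (low h hh le_rfl) m1
    have e1 : r 1 (h + 1) := hr.trans e0 m2
    have e2 : r 1 (3 * h + 3) := hr.trans e1 m3
    -- `3 * h + 3, …, 4 * h + 2` are connected by `x ↦ x - 2 * h ↦ x + 1`
    have b1 : ∀ x, 1 ≤ x → x ≤ h - 1 → r (x + 3 * h + 2) (x + h + 2) := fun x h1 h2 =>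
      h' (x + 3 * h + 2) (x + h + 2) (by omega) (by omega)
        (by have := sigmaThree_cases hh (x + 3 * h + 2); omega)
    have b2 : ∀ x, 1 ≤ x → x ≤ h - 1 → r (x + h + 2) (x + 1 + 3 * h + 2) := fun x h1 h2 =>
      h' (x + h + 2) (x + 1 + 3 * h + 2) (by omega) (by omega)
        (by have := sigmaThree_cases hh (x + h + 2); omega)
    have high : ∀ x, 1 ≤ x → x ≤ h → r 1 (x + 3 * h + 2) := by
      intro x h1
      induction x, h1 using Nat.le_induction with
      | base => exact fun _ => by rwa [show 1 + 3 * h + 2 = 3 * h + 3 by omega]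
      | succ x h1 ih =>
        intro h2
        exact hr.trans (ih (by omega)) (hr.trans (b1 x h1 (by omega)) (b2 x h1 (by omega)))
    have l1 : r (2 * h + 2) (2 * h + 3) :=
      h' (2 * h + 2) (2 * h + 3) (by omega) (by omega)
        (by have := sigmaThree_cases hh (2 * h + 2); omega)
    have l2 : r (2 * h + 3) 1 :=
      h' (2 * h + 3) 1 (by omega) (by omega)
        (by have := sigmaThree_cases hh (2 * h + 3); omega)
    intro x hx1 hx2
    rcases le_or_gt x h with h1 | h1
    · exact low x hx1 h1
    rcases eq_or_ne x (h + 1) with rfl | h2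
    · exact e1
    rcases eq_or_ne x (h + 2) with rfl | h3
    · exact e0
    rcases le_or_gt x (2 * h + 1) with h4 | h4
    · have := b1 (x - h - 2) (by omega) (by omega)
      rw [show x - h - 2 + h + 2 = x by omega] at this
      exact hr.trans (high _ (by omega) (by omega)) this
    rcases eq_or_ne x (2 * h + 2) with rfl | h5
    · exact hr.symm (hr.trans l1 l2)
    rcases eq_or_ne x (2 * h + 3) with rfl | h6
    · exact hr.symm l2
    rcases le_or_gt x (3 * h + 2) with h7 | h7
    · have := a1 (x - 2 * h - 3) (by omega) (by omega)
      rw [show x - 2 * h - 3 + 2 * h + 3 = x by omega] at this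
      exact hr.trans (low _ (by omega) (by omega)) this
    · have := high (x - 3 * h - 2) (by omega) (by omega)
      rwa [show x - 3 * h - 2 + 3 * h + 2 = x by omega] at this

/-- A permutation of the integers modulo `4 * h + 2`, written on the representatives below
`4 * h + 2`, that maps `2 * h + 1` to `0` and has distinct nonzero displacements elsewhere. No
permutation of a cyclic group of even order has distinct displacements everywhere. -/
def phiTwo (h x : ℕ) : ℕ :=
  if x ≤ h - 1 then 2 * h - x else if x = h then 3 * h + 1 
  else if x ≤ 2 * h + 1 then 2 * h + 1 - x else if x ≤ 3 * h + 1 then 6 * h + 3 - x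
  else 6 * h + 2 - x

theorem phiTwo_cases {h : ℕ} (hh : 1 ≤ h) (x : ℕ) :
    (x ≤ h - 1 ∧ phiTwo h x = 2 * h - x) ∨
    (x = h ∧ phiTwo h x = 3 * h + 1) ∨
    (h + 1 ≤ x ∧ x ≤ 2 * h + 1 ∧ phiTwo h x = 2 * h + 1 - x) ∨
    (2 * h + 2 ≤ x ∧ x ≤ 3 * h + 1 ∧ phiTwo h x = 6 * h + 3 - x) ∨
    (3 * h + 2 ≤ x ∧ phiTwo h x = 6 * h + 2 - x) := by
  unfold phiTwo
  split_ifs <;>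
    repeat first
      | exact ⟨by omega, rfl⟩
      | exact .inl ⟨by omega, rfl⟩
      | exact .inl ⟨by omega, by omega, rfl⟩
      | refine .inr ?_

theorem hasBlocks_four_mul_add_three {h : ℕ} (hh : 1 ≤ h) : HasBlocks (4 * h + 2 + 1) := by
  refine hasBlocks_of_perm_nat (a := 2 * h + 1) (b := 2 * h + 3) (by omega) (phiTwo h) (by omega)
    (by omega) ?_ ?_ ?_ ?_ ?_ ?_ ?_
  · intro x hx
    have := phiTwo_cases hh x
    omega
  · intro x hx y hy e
    have hsx := phiTwo_cases hh x
    have hsy := phiTwo_cases hh y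
    generalize phiTwo h x = sx at *
    generalize phiTwo h y = sy at *
    rcases hsx with h1 | h1 | h1 | h1 | h1 <;>
      rcases hsy with h2 | h2 | h2 | h2 | h2 <;> omega
  · unfold phiTwo
    split_ifs <;> omega
  · intro x hx y hy hxa hya e
    have hsx := phiTwo_cases hh x
    have hsy := phiTwo_cases hh y
    generalize phiTwo h x = sx at *
    generalize phiTwo h y = sy at *
    rcases hsx with h1 | h1 | h1 | h1 | h1 <;>
      rcases hsy with h2 | h2 | h2 | h2 | h2 <;> omega
  · intro x hx hxa
    have := phiTwo_cases hh x
    omega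
  · unfold phiTwo
    split_ifs <;> omega
  -- the greatest common divisor divides `2 * (2 * h + 3) - (4 * h + 2) = 4` and is odd
  · have h1 : Nat.gcd (2 * h + 3) (4 * h + 2) ∣ 4 := by
      have := Nat.dvd_sub ((Nat.gcd_dvd_left (2 * h + 3) (4 * h + 2)).mul_left 2)
        (Nat.gcd_dvd_right (2 * h + 3) (4 * h + 2))
      rwa [show 2 * (2 * h + 3) - (4 * h + 2) = 4 by omega] at this
    have h2 : Nat.Coprime (2 * h + 3) 4 := by
      rw [show 4 = 2 ^ 2 by norm_num]
      exact Nat.Coprime.pow_right 2 (Nat.coprime_two_right.2 (by grind))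
    exact Nat.dvd_one.1 (h2 ▸ Nat.dvd_gcd (Nat.gcd_dvd_left _ _) h1)

/-- A permutation of the integers modulo `4 * h`, written on the representatives below `4 * h`, that
maps `2 * h` to `0` and has distinct nonzero displacements elsewhere. -/
def phiZero (h x : ℕ) : ℕ :=
  if x = 0 then 2 else if x ≤ h - 1 then 4 * h - x else if x = h then h + 1
  else if x ≤ 2 * h - 1 then 4 * h + 1 - x else if x = 2 * h then 0 else if x = 2 * h + 1 then 1
  else if x ≤ 3 * h + 1 then 4 * h + 3 - x else 4 * h + 2 - x

theorem phiZero_cases {h : ℕ} (hh : 2 ≤ h) (x : ℕ) :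
    (x = 0 ∧ phiZero h x = 2) ∨
    (1 ≤ x ∧ x ≤ h - 1 ∧ phiZero h x = 4 * h - x) ∨
    (x = h ∧ phiZero h x = h + 1) ∨
    (h + 1 ≤ x ∧ x ≤ 2 * h - 1 ∧ phiZero h x = 4 * h + 1 - x) ∨
    (x = 2 * h ∧ phiZero h x = 0) ∨
    (x = 2 * h + 1 ∧ phiZero h x = 1) ∨
    (2 * h + 2 ≤ x ∧ x ≤ 3 * h + 1 ∧ phiZero h x = 4 * h + 3 - x) ∨
    (3 * h + 2 ≤ x ∧ phiZero h x = 4 * h + 2 - x) := by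
  unfold phiZero
  split_ifs <;>
    repeat first
      | exact ⟨by omega, rfl⟩
      | exact .inl ⟨by omega, rfl⟩
      | exact .inl ⟨by omega, by omega, rfl⟩
      | refine .inr ?_

theorem hasBlocks_four_mul_add_one {h : ℕ} (hh : 2 ≤ h) : HasBlocks (4 * h + 1) := by
  refine hasBlocks_of_perm_nat (a := 2 * h) (b := 4 * h - 1) (by omega) (phiZero h) (by omega)
    (by omega) ?_ ?_ ?_ ?_ ?_ ?_ ?_
  · intro x hx
    have := phiZero_cases hh x
    omega
  · intro x hx y hy e
    have hsx := phiZero_cases hh x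
    have hsy := phiZero_cases hh y
    generalize phiZero h x = sx at *
    generalize phiZero h y = sy at *
    rcases hsx with h1 | h1 | h1 | h1 | h1 | h1 | h1 | h1 <;>
      rcases hsy with h2 | h2 | h2 | h2 | h2 | h2 | h2 | h2 <;> omega
  · unfold phiZero
    split_ifs <;> omega
  · intro x hx y hy hxa hya e
    have hsx := phiZero_cases hh x
    have hsy := phiZero_cases hh y
    generalize phiZero h x = sx at *
    generalize phiZero h y = sy at *
    rcases hsx with h1 | h1 | h1 | h1 | h1 | h1 | h1 | h1 <;>
      rcases hsy with h2 | h2 | h2 | h2 | h2 | h2 | h2 | h2 <;> omega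
  · intro x hx hxa
    have := phiZero_cases hh x
    omega
  · unfold phiZero
    split_ifs <;> omega
  · have := Nat.coprime_self_add_right (m := 4 * h - 1) (n := 1)
    rw [show 4 * h - 1 + 1 = 4 * h by omega] at this
    exact this.2 (Nat.coprime_one_right _)

/-! ### Blocks of orders `4` and `5` -/

/-- The two Latin squares have the rows `l c` and `l' c`. -/
theorem hasBlocks_five : HasBlocks 5 := by
  let l : Fin 5 → Fin 5 → Fin 5 := ![![0, 1, 2, 3, 4], ![1, 0, 3, 4, 2], ![2, 3, 4, 1, 0],
    ![3, 4, 0, 2, 1], ![4, 2, 1, 0, 3]]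
  let l' : Fin 5 → Fin 5 → Fin 5 := ![![2, 1, 3, 4, 0], ![3, 2, 0, 1, 4], ![1, 4, 2, 0, 3],
    ![4, 0, 1, 3, 2], ![0, 3, 4, 2, 1]]
  have hl : ∀ c, Function.Injective (l c) := by decide
  have hl' : ∀ c, Function.Injective (l' c) := by decide
  have hc : ∀ x, Function.Injective fun c => l c x := by decide
  have hc' : ∀ x, Function.Injective fun c => l' c x := by decide
  let L : Fin 5 → Equiv.Perm (Fin 5) := fun c =>
    Equiv.ofBijective (l c) (Finite.injective_iff_bijective.1 (hl c))
  let L' : Fin 5 → Equiv.Perm (Fin 5) := fun c =>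
    Equiv.ofBijective (l' c) (Finite.injective_iff_bijective.1 (hl' c))
  have same : ∀ (f : Equiv.Perm (Fin 5)) (g : Fin 5 → Fin 5), (∀ x, f x = g x) →
      ∀ x y, (∃ n < 5, g^[n] x = y) → f.SameCycle x y := by
    rintro f g hg x y ⟨n, -, rfl⟩
    obtain rfl : ⇑f = g := funext hg
    exact ⟨n, by rw [zpow_natCast, Equiv.Perm.iterate_eq_pow]⟩
  have h0 : ∀ x, l 0 x = x := by decide
  have h1 : ∀ x y : Fin 5, x ≠ 1 → y ≠ 1 → ∃ n < 5, (l' 0)^[n] x = y := by decide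
  have h2 : ∀ c : Fin 5, c ≠ 0 → ∀ x y : Fin 5, ∃ n < 5, (fun x => l' c (l c x))^[n] x = y := by
    decide
  exact IsLatinCore.hasBlocks (X := Fin 5) (k₀ := (0 : Fin 5)) (v := 1) (L := L) (L' := L')
    (by norm_num) rfl
    { latin := fun x => (Finite.injective_iff_bijective.1 (hc x)).existsUnique
      latin' := fun x => (Finite.injective_iff_bijective.1 (hc' x)).existsUnique
      eq_one := Equiv.ext h0
      fixed := rfl
      sameCycle := fun x y hx hy => same (L' 0) (l' 0) (fun _ => rfl) x y (h1 x y hx hy)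
      sameCycle_mul := fun c hc x y =>
        same (L' c * L c) (fun x => l' c (l c x)) (fun _ => rfl) x y (h2 c hc x y) }

instance {m : ℕ} {vert : Prop} [Decidable vert] (p : Bool × ZMod m)
    (t : (Bool × ZMod m) ⊕ ZMod m) : Decidable (blockArc m vert p t) :=
  match p, t with
  | (false, x), .inl (false, y) => inferInstanceAs (Decidable (vert ∧ y = x + 1))
  | (false, _), .inl (true, _) => .isTrue trivial
  | (false, _), .inr _ => .isFalse id
  | (true, _), .inl (false, _) => .isFalse id
  | (true, x), .inl (true, y) => inferInstanceAs (Decidable (vert ∧ y = x - 1))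
  | (true, _), .inr _ => .isTrue trivial

theorem Relation.EqvGen.iterate {α : Type*} {r : α → α → Prop} {f : α → α}
    (h : ∀ a, Relation.EqvGen r a (f a)) (n : ℕ) (a : α) : Relation.EqvGen r a (f^[n] a) := by
  induction n generalizing a with
  | zero => exact .refl a
  | succ n ih => exact (h a).trans _ _ _ (ih (f a))

/-- Unlike for larger orders, the arcs within a layer are shared by three of the five colours, which
take two, one and one of them. -/
theorem hasBlocks_four : HasBlocks 4 := by
  let s : Fin 5 → Bool × ZMod 4 → (Bool × ZMod 4) ⊕ ZMod 4 := fun c p => match p with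
    | (false, x) => (![![.inl (false, 1), .inl (false, 2), .inl (true, 1), .inl (true, 2)],
        ![.inl (true, 0), .inl (true, 2), .inl (false, 3), .inl (true, 3)],
        ![.inl (true, 3), .inl (true, 1), .inl (true, 0), .inl (false, 0)],
        ![.inl (true, 1), .inl (true, 3), .inl (true, 2), .inl (true, 0)],
        ![.inl (true, 2), .inl (true, 0), .inl (true, 3), .inl (true, 1)]] :
        Fin 5 → Fin 4 → (Bool × ZMod 4) ⊕ ZMod 4) c x
    | (true, x) => (![![.inl (true, 3), .inl (true, 0), .inr 0, .inr 3],
        ![.inr 2, .inr 0, .inl (true, 1), .inr 1],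
        ![.inr 1, .inr 3, .inr 2, .inl (true, 2)],
        ![.inr 0, .inr 1, .inr 3, .inr 2],
        ![.inr 3, .inr 2, .inr 1, .inr 0]] : Fin 5 → Fin 4 → (Bool × ZMod 4) ⊕ ZMod 4) c x
  let s' : Fin 5 → Bool × ZMod 4 → (Bool × ZMod 4) ⊕ ZMod 4 := fun c p => match p with
    | (false, x) => (![![.inl (false, 1), .inl (false, 2), .inl (true, 1), .inl (true, 2)],
        ![.inl (true, 0), .inl (true, 1), .inl (false, 3), .inl (true, 3)],
        ![.inl (true, 3), .inl (true, 0), .inl (true, 2), .inl (false, 0)],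
        ![.inl (true, 1), .inl (true, 2), .inl (true, 3), .inl (true, 0)],
        ![.inl (true, 2), .inl (true, 3), .inl (true, 0), .inl (true, 1)]] :
        Fin 5 → Fin 4 → (Bool × ZMod 4) ⊕ ZMod 4) c x
    | (true, x) => (![![.inl (true, 3), .inl (true, 0), .inr 3, .inr 0],
        ![.inr 0, .inr 1, .inr 2, .inl (true, 2)],
        ![.inr 1, .inr 2, .inl (true, 1), .inr 3],
        ![.inr 3, .inr 0, .inr 1, .inr 2],
        ![.inr 2, .inr 3, .inr 0, .inr 1]] : Fin 5 → Fin 4 → (Bool × ZMod 4) ⊕ ZMod 4) c x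
  -- the entry sets: the heads of the arcs of a colour in the first layer are excluded
  let e : Fin 5 → ZMod 4 → Bool :=
    ![![true, false, false, true], ![true, true, true, false], ![false, true, true, true],
      fun _ => true, fun _ => true]
  have block : IsBlock True (fun c => {x | e c x = true}) s :=
    ⟨by decide, by decide, by decide, by decide, by decide, by decide⟩
  have block' : IsBlock True (fun c => {x | e c x = true}) s' :=
    ⟨by decide, by decide, by decide, by decide, by decide, by decide⟩
  refine ⟨Fin 5, inferInstance, fun c => {x | e c x = true}, s, s', block, block', ?_, ?_⟩
  · have h : ∀ c p, ∃ n < 8,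
        (fun p => Sum.elim id (fun y => (false, y)) (s c p))^[n] (false, 0) = p := by decide
    intro c
    have all : ∀ p, Relation.EqvGen
        (fun a b => Sum.elim id (fun y => (false, y)) (s c a) = b) (false, 0) p := by
      intro p
      obtain ⟨n, -, rfl⟩ := h c p
      exact .iterate (fun a => .rel _ _ rfl) n _
    exact fun p q => .trans _ _ _ (.symm _ _ (all p)) (all q)
  · have h : ∀ c, (∀ x, e c x = true → ∃ n < 9,
        (fun t => Sum.elim (s' c) .inr t)^[n] (.inl (false, x)) = .inr x) ∧
        ∀ p, ∃ x, e c x = true ∧ ∃ n < 8,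
          (fun t => Sum.elim (s' c) .inr t)^[n] (.inl (false, x)) = .inl p := by decide
    intro c
    have step : ∀ t, Relation.EqvGen (fun a b => ∃ p, a = .inl p ∧ b = s' c p) t
        (Sum.elim (s' c) .inr t) := by
      rintro (p | y)
      · exact .rel _ _ ⟨p, rfl, rfl⟩
      · exact .refl _
    refine ⟨fun x hx => ?_, fun p => ?_⟩
    · obtain ⟨n, -, hn⟩ := (h c).1 x hx
      rw [← hn]
      exact .iterate step n _
    · obtain ⟨x, hx, n, -, hn⟩ := (h c).2 p
      refine ⟨x, hx, .symm _ _ ?_⟩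
      rw [← hn]
      exact .iterate step n _

/-! ### Wreath products with a long cycle -/

theorem hasBlocks_of_four_le {m : ℕ} (hm : 4 ≤ m) : HasBlocks m := by
  obtain ⟨k, hk⟩ : ∃ k, m = 4 * k ∨ m = 4 * k + 1 ∨ m = 4 * k + 2 ∨ m = 4 * k + 3 :=
    ⟨m / 4, by omega⟩
  rcases hk with rfl | rfl | rfl | rfl
  · rcases eq_or_ne k 1 with rfl | h
    · exact hasBlocks_four
    · obtain ⟨l, rfl⟩ : ∃ l, k = l + 1 := ⟨k - 1, by omega⟩
      exact hasBlocks_four_mul_add_four (h := l) (by omega)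
  · rcases eq_or_ne k 1 with rfl | h
    · exact hasBlocks_five
    · exact hasBlocks_four_mul_add_one (by omega)
  · exact hasBlocks_four_mul_add_two (by omega)
  · exact hasBlocks_four_mul_add_three (by omega)

/-- The block without arcs in its layers in which colour `c` moves by `c` to the second layer, and
leaves the block displaced by `d`. -/
def rotationStep {m : ℕ} (d c : ZMod m) : Bool × ZMod m → (Bool × ZMod m) ⊕ ZMod m
  | (false, x) => .inl (true, x + c)
  | (true, x) => .inr (x - c + d)

theorem isBlock_rotationStep {m : ℕ} (d : ZMod m) :
    IsBlock False (fun _ => Set.univ) (rotationStep d) := by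
  refine ⟨?_, ?_, ?_, ?_, fun _ _ _ _ => trivial, ?_⟩
  · rintro c ⟨_ | _, x⟩ <;> trivial
  · rintro ⟨_ | _, x⟩ (⟨_ | _, y⟩ | y) h
    · exact h.1.elim
    · exact ⟨y - x, by simp [rotationStep]⟩
    · exact h.elim
    · exact h.elim
    · exact h.1.elim
    · exact ⟨x + d - y, by simp only [rotationStep, Sum.inr.injEq]; ring⟩
  · rintro c c' ⟨_ | _, x⟩ h <;> simpa [rotationStep] using h
  · rintro c ⟨_ | _, x⟩ ⟨_ | _, y⟩ h <;>
      simp only [rotationStep, Sum.inl.injEq, Sum.inr.injEq, Prod.mk.injEq, true_and, reduceCtorEq,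
        add_left_inj, sub_left_inj] at h <;> rw [h]
  · rintro c ⟨_ | _, x⟩ y h <;> simp [rotationStep] at h

theorem isPassThrough_rotationStep {m : ℕ} :
    IsPassThrough (fun _ => Set.univ) (rotationStep (0 : ZMod m)) := by
  intro c
  have h1 : ∀ x, Relation.EqvGen (fun a b => ∃ p, a = .inl p ∧ b = rotationStep 0 c p)
      (.inl (false, x)) (.inl (true, x + c)) := fun x => .rel _ _ ⟨_, rfl, rfl⟩
  refine ⟨fun x _ => (h1 x).trans _ _ _ (.rel _ _ ⟨_, rfl, by simp [rotationStep]⟩), ?_⟩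
  rintro ⟨_ | _, x⟩
  · exact ⟨x, trivial, .refl _⟩
  · exact ⟨x - c, trivial, .symm _ _ (by simpa using h1 (x - c))⟩

theorem isLoop_rotationStep {m : ℕ} [NeZero m] : IsLoop (rotationStep (1 : ZMod m)) := by
  intro c p q
  have hr := Relation.EqvGen.is_equivalence
    (fun a b => Sum.elim id (fun y => (false, y)) (rotationStep 1 c a) = b)
  have h1 : ∀ x, Relation.EqvGen
      (fun a b => Sum.elim id (fun y => (false, y)) (rotationStep 1 c a) = b)
      (false, x) (true, x + c) := fun x => .rel _ _ rfl
  have h2 : ∀ x, Relation.EqvGen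
      (fun a b => Sum.elim id (fun y => (false, y)) (rotationStep 1 c a) = b)
      (false, x) (false, x + 1) := fun x =>
    hr.trans (h1 x) (.rel _ _ (by simp [rotationStep]))
  have h3 : ∀ n : ℕ, Relation.EqvGen
      (fun a b => Sum.elim id (fun y => (false, y)) (rotationStep 1 c a) = b)
      (false, 0) (false, (n : ZMod m)) := by
    intro n
    induction n with
    | zero => rw [Nat.cast_zero]; exact hr.refl _
    | succ n ih => rw [Nat.cast_succ]; exact hr.trans ih (h2 n)
  have h4 : ∀ p, Relation.EqvGen
      (fun a b => Sum.elim id (fun y => (false, y)) (rotationStep 1 c a) = b) (false, 0) p := by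
    have h5 : ∀ x : ZMod m, _ := fun x => h3 x.val
    simp only [ZMod.natCast_zmod_val] at h5
    rintro ⟨_ | _, x⟩
    · exact h5 x
    · have := hr.trans (h5 (x - c)) (h1 _)
      rwa [sub_add_cancel] at this
  exact hr.trans (hr.symm (h4 p)) (h4 q)

theorem Digraph.HamiltonianDecomposable.nontrivial {V : Type*} {G : Digraph V}
    (h : G.HamiltonianDecomposable) : Nontrivial V := by
  obtain ⟨D, hD⟩ := h
  obtain ⟨C, hC⟩ := hD.nonempty
  obtain ⟨-, k, hk, ⟨e⟩⟩ := hD.isHamiltonianDicycle C hC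
  have : Fact (1 < k) := ⟨hk⟩
  exact e.toEquiv.nontrivial

/-- If `G` has even order, then the arcs of one cycle of `G` and the arcs in the layers are
decomposed together, and the arcs of every other cycle of `G` are decomposed on their own. -/
theorem Digraph.HamiltonianDecomposable.wreath_dicycle {V : Type*} [Fintype V] {G : Digraph V}
    (hG : G.HamiltonianDecomposable) (hV : Even (Fintype.card V)) {m : ℕ} [NeZero m]
    (hm : HasBlocks m) : (G.wreath (Digraph.dicycle m)).HamiltonianDecomposable := by
  have := hG.nontrivial
  obtain ⟨k, hk⟩ := hV.two_dvd
  have : NeZero k := ⟨fun h => Fintype.card_ne_zero (hk.trans (by rw [h, mul_zero]))⟩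
  obtain ⟨D, f, hf⟩ := hG.exists_isPermDecomposition
  obtain ⟨t₀⟩ := hf.nonempty
  -- arcs within a layer cannot be confused with arcs over an arc of `G`, as `G` has no loops
  have hfix : ∀ t x, f t x ≠ x := by
    intro t x hx
    obtain ⟨y, hy⟩ := exists_ne x
    obtain ⟨i, hi⟩ := hf.sameCycle t x y
    exact hy (hi.symm.trans (Equiv.Perm.zpow_apply_eq_self_of_apply_eq_self hx i))
  obtain ⟨K, _, E, s, s', hs, hs', hl, hp⟩ := hm
  obtain ⟨f₀, hf₀⟩ := layered_isPermDecomposition hk (hf.sameCycle t₀) hs hs' hl hp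
  choose f₁ hf₁ using fun t : D => layered_isPermDecomposition hk (hf.sameCycle t)
    (isBlock_rotationStep (m := m) 1) (isBlock_rotationStep 0) isLoop_rotationStep
    isPassThrough_rotationStep
  have h₀ : ∀ c u, f t₀ u.1 = (f₀ c u).1 ∨ u.1 = (f₀ c u).1 ∧ (f₀ c u).2 = u.2 + 1 := fun c u => by
    simpa [layered] using (hf₀.adj_iff u (f₀ c u)).2 ⟨c, rfl⟩
  have h₁ : ∀ t c u, f t u.1 = (f₁ t c u).1 := fun t c u => by
    simpa [layered] using ((hf₁ t).adj_iff u (f₁ t c u)).2 ⟨c, rfl⟩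
  have key : ∀ c t c' u, t ≠ t₀ → f₀ c u ≠ f₁ t c' u := by
    intro c t c' u ht h
    have e1 := h₁ t c' u
    rcases h₀ c u with e | e
    · exact ht (hf.color_inj _ _ u.1 (e1.trans ((congrArg Prod.fst h).symm.trans e.symm)))
    · exact hfix t u.1 (e1.trans ((congrArg Prod.fst h).symm.trans e.1.symm))
  refine IsPermDecomposition.hamiltonianDecomposable (K := K ⊕ {t // t ≠ t₀} × ZMod m)
    (f := Sum.elim f₀ fun p => f₁ p.1 p.2) ⟨inferInstance, ?_, ?_, ?_⟩
  · rintro (c | ⟨t, c⟩)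
    exacts [hf₀.sameCycle c, (hf₁ t).sameCycle c]
  · intro u v
    constructor
    · rintro (h | ⟨h, h'⟩)
      · obtain ⟨t, ht⟩ := (hf.adj_iff _ _).1 h
        by_cases htt : t = t₀
        · obtain ⟨c, hc⟩ := (hf₀.adj_iff u v).1 (.inl (htt ▸ ht))
          exact ⟨.inl c, hc⟩
        · obtain ⟨c, hc⟩ := ((hf₁ t).adj_iff u v).1 (.inl ht)
          exact ⟨.inr (⟨t, htt⟩, c), hc⟩
      · obtain ⟨c, hc⟩ := (hf₀.adj_iff u v).1 (.inr ⟨trivial, h, h'⟩)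
        exact ⟨.inl c, hc⟩
    · rintro ⟨c | ⟨t, c⟩, rfl⟩
      · rcases h₀ c u with e | e
        · exact .inl ((hf.adj_iff _ _).2 ⟨t₀, e⟩)
        · exact .inr e
      · exact .inl ((hf.adj_iff _ _).2 ⟨t, h₁ t c u⟩)
  · rintro (c | ⟨⟨t, ht⟩, c⟩) (c' | ⟨⟨t', ht'⟩, c'⟩) u h
    · rw [hf₀.color_inj c c' u h]
    · exact (key _ _ _ _ ht' h).elim
    · exact (key _ _ _ _ ht h.symm).elim
    · have htt : t = t' := hf.color_inj t t' u.1
        ((h₁ t c u).trans ((congrArg Prod.fst h).trans (h₁ t' c' u).symm))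
      subst htt
      rw [(hf₁ t).color_inj c c' u h]

/-! ### Signs of transitive permutations of the layers -/

theorem Equiv.Perm.sign_of_sameCycle {V : Type*} [Fintype V] [DecidableEq V] [Nontrivial V]
    {f : Equiv.Perm V} (hf : ∀ x y, f.SameCycle x y) :
    Equiv.Perm.sign f = -(-1) ^ Fintype.card V := by
  have hne : ∀ x, f x ≠ x := by
    intro x hx
    obtain ⟨y, hy⟩ := exists_ne x
    obtain ⟨i, hi⟩ := hf x y
    exact hy (hi.symm.trans (Equiv.Perm.zpow_apply_eq_self_of_apply_eq_self hx i))
  obtain ⟨v⟩ : Nonempty V := inferInstance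
  have hc : f.IsCycle := ⟨v, hne v, fun y _ => hf v y⟩
  rw [hc.sign, ← Finset.card_univ]
  congr 3
  ext x
  simpa using hne x

section Sign

variable {n m : ℕ}

theorem ZMod.sign_addRight_one [NeZero n] [Fact (1 < n)] (hn : Even n) :
    Equiv.Perm.sign (Equiv.addRight (1 : ZMod n)) = -1 := by
  rw [Equiv.Perm.sign_of_sameCycle, ZMod.card, hn.neg_one_pow]
  intro x y
  have : ∀ k : ℕ, ((Equiv.addRight (1 : ZMod n)) ^ k) x = x + k := by
    intro k
    induction k with
    | zero => simp
    | succ k ih =>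
      rw [pow_succ', Equiv.Perm.mul_apply, ih]
      simp [add_assoc]
  exact ⟨(y - x).val, by rw [zpow_natCast, this, ZMod.natCast_zmod_val, add_sub_cancel]⟩

/-- The permutation that maps each layer to the next one by the permutations `π i`. -/
def layerPerm (π : ZMod n → Equiv.Perm (ZMod m)) : Equiv.Perm (ZMod n × ZMod m) :=
  Equiv.prodCongrLeft (fun _ => Equiv.addRight 1) * Equiv.prodCongrRight π

theorem layerPerm_apply (π : ZMod n → Equiv.Perm (ZMod m)) (i : ZMod n) (x : ZMod m) :
    layerPerm π (i, x) = (i + 1, π i x) := rfl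

section

variable [NeZero n] [NeZero m] [Fact (1 < n)]

theorem sign_layerPerm (hn : Even n) (π : ZMod n → Equiv.Perm (ZMod m)) :
    Equiv.Perm.sign (layerPerm π) = (-1) ^ m * ∏ i, Equiv.Perm.sign (π i) := by
  rw [layerPerm, Equiv.Perm.sign_mul, Equiv.Perm.sign_prodCongrLeft,
    Equiv.Perm.sign_prodCongrRight, Finset.prod_const, ZMod.sign_addRight_one hn,
    Finset.card_univ, ZMod.card]

theorem sign_of_sameCycle_layers (hn : Even n) {f : Equiv.Perm (ZMod n × ZMod m)}
    (hf : ∀ u v, f.SameCycle u v) : Equiv.Perm.sign f = -1 := by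
  rw [Equiv.Perm.sign_of_sameCycle hf, Fintype.card_prod, ZMod.card, ZMod.card,
    (hn.mul_right m).neg_one_pow]

/-- The sign of a transitive permutation that takes no arcs within the layers. -/
theorem prod_sign_of_forall (hn : Even n) {f : Equiv.Perm (ZMod n × ZMod m)}
    (hf : ∀ u v, f.SameCycle u v) {π : ZMod n → Equiv.Perm (ZMod m)}
    (h : ∀ i x, f (i, x) = (i + 1, π i x)) :
    (-1) ^ m * ∏ i, Equiv.Perm.sign (π i) = -1 := by
  obtain rfl : f = layerPerm π := Equiv.ext fun u => h u.1 u.2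
  rw [← sign_layerPerm hn, sign_of_sameCycle_layers hn hf]

/-- If a transitive permutation `f` takes one arc in each layer, with tail `t i`, then replacing
these arcs by arcs to the next layer multiplies `f` by a cycle of length `n`. -/
theorem prod_sign_of_tail (hn : Even n) {f : Equiv.Perm (ZMod n × ZMod m)}
    (hf : ∀ u v, f.SameCycle u v) {π : ZMod n → Equiv.Perm (ZMod m)} {t : ZMod n → ZMod m}
    (ht : ∀ i, f (i, t i) = (i, t i + 1)) (hπ : ∀ i, π i (t i) = t (i + 1) + 1)
    (h : ∀ i x, x ≠ t i → f (i, x) = (i + 1, π i x)) :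
    (-1) ^ m * ∏ i, Equiv.Perm.sign (π i) = 1 := by
  let ι : ZMod n ↪ ZMod n × ZMod m := ⟨fun i => (i, t i + 1), fun i j h => congrArg Prod.fst h⟩
  have key : (Equiv.addRight (1 : ZMod n)).viaFintypeEmbedding ι * f = layerPerm π := by
    ext1 ⟨i, x⟩
    rw [Equiv.Perm.mul_apply, layerPerm_apply]
    by_cases hx : x = t i
    · rw [hx, ht, hπ]
      exact Equiv.Perm.viaFintypeEmbedding_apply_image _ ι i
    · rw [h i x hx, Equiv.Perm.viaFintypeEmbedding_apply_notMem_range]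
      rintro ⟨j, hj⟩
      obtain rfl : j = i + 1 := congrArg Prod.fst hj
      exact hx ((π i).injective ((congrArg Prod.snd hj).symm.trans (hπ i).symm))
  rw [← sign_layerPerm hn, ← key, Equiv.Perm.sign_mul, sign_of_sameCycle_layers hn hf,
    Equiv.Perm.viaFintypeEmbedding_sign, ZMod.sign_addRight_one hn]
  rfl

end

/-- Each arc `(u, f u)` is an arc of the wreath product of two directed cycles. -/
def IsWreathStep (f : Equiv.Perm (ZMod n × ZMod m)) : Prop :=
  ∀ i x, (f (i, x)).1 = i + 1 ∨ f (i, x) = (i, x + 1)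

/-- The tails of the arcs of `f` in the layer with index `i`. -/
def tails [NeZero m] (f : Equiv.Perm (ZMod n × ZMod m)) (i : ZMod n) : Finset (ZMod m) :=
  {x | f (i, x) = (i, x + 1)}

variable {f : Equiv.Perm (ZMod n × ZMod m)}

theorem mem_tails [NeZero m] {i : ZMod n} {x : ZMod m} : x ∈ tails f i ↔ f (i, x) = (i, x + 1) := by
  simp [tails]

theorem IsWreathStep.eq_of_notMem [NeZero m] (hs : IsWreathStep f) {i : ZMod n} {x : ZMod m}
    (hx : x ∉ tails f i) : f (i, x) = (i + 1, (f (i, x)).2) :=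
  Prod.ext ((hs i x).resolve_right fun h => hx (mem_tails.2 h)) rfl

variable [NeZero m] [Fact (1 < n)]

/-- A vertex that is entered from the previous layer is not entered from its own layer. -/
theorem IsWreathStep.sub_notMem (hs : IsWreathStep f) {i : ZMod n} {x : ZMod m}
    (hx : x ∉ tails f i) : (f (i, x)).2 - 1 ∉ tails f (i + 1) := by
  intro h
  rw [mem_tails, sub_add_cancel, ← hs.eq_of_notMem hx, f.injective.eq_iff] at h
  exact (by simp : i + 1 ≠ i) (congrArg Prod.fst h)

/-- The number of arcs in a layer is the same for all layers, because the remaining arcs that leave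
a layer are as many as those that enter the next one. -/
theorem IsWreathStep.card_tails [NeZero n] (hs : IsWreathStep f) (i j : ZMod n) :
    (tails f i).card = (tails f j).card := by
  have h1 : ∀ i, (tails f (i + 1)).card ≤ (tails f i).card := by
    intro i
    have : (tails f i)ᶜ.card ≤ (tails f (i + 1))ᶜ.card := by
      refine Finset.card_le_card_of_injOn (fun x => (f (i, x)).2 - 1) ?_ ?_
      · intro x hx
        simp only [Finset.coe_compl, Set.mem_compl_iff, Finset.mem_coe] at hx ⊢
        exact hs.sub_notMem hx
      · intro x hx y hy hxy
        simp only [Finset.coe_compl, Set.mem_compl_iff, Finset.mem_coe, sub_left_inj] at hx hy hxy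
        have := (hs.eq_of_notMem hx).trans (by rw [hxy, ← hs.eq_of_notMem hy])
        exact congrArg Prod.snd (f.injective this)
    have h2 := (tails f i).card_add_card_compl
    have h3 := (tails f (i + 1)).card_add_card_compl
    omega
  have h2 : ∀ (i : ZMod n) (k : ℕ), (tails f (i + k)).card ≤ (tails f i).card := by
    intro i k
    induction k with
    | zero => simp
    | succ k ih =>
      rw [Nat.cast_succ, ← add_assoc]
      exact (h1 _).trans ih
  have h3 : ∀ i j : ZMod n, (tails f j).card ≤ (tails f i).card := fun i j => by
    simpa using h2 i (j - i).val
  exact le_antisymm (h3 _ _) (h3 _ _)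

/-- A transitive permutation has to leave each layer. -/
theorem card_tails_lt [NeZero n] (hf : ∀ u v, f.SameCycle u v) (i : ZMod n) :
    (tails f i).card < m := by
  by_contra! h
  have hu : tails f i = Finset.univ := by
    rw [← Finset.card_eq_iff_eq_univ, ZMod.card]
    exact le_antisymm ((Finset.card_le_univ _).trans (ZMod.card m).le) h
  have hstay : ∀ x, f (i, x) = (i, x + 1) := fun x => mem_tails.1 (hu ▸ Finset.mem_univ x)
  have hpow : ∀ k : ℕ, ((f ^ k) (i, 0)).1 = i := by
    intro k
    induction k with
    | zero => rfl
    | succ k ih =>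
      have := hstay ((f ^ k) (i, 0)).2
      nth_rw 1 [← ih, Prod.mk.eta] at this
      rw [pow_succ', Equiv.Perm.mul_apply, this]
  obtain ⟨k, hk⟩ := (hf (i, 0) (i + 1, 0)).exists_nat_pow_eq
  have := hpow k
  rw [hk] at this
  exact (by simp : i + 1 ≠ i) this

variable [NeZero n]

theorem IsWreathStep.exists_perm_of_card_eq_zero (hs : IsWreathStep f) {i₀ : ZMod n}
    (h : (tails f i₀).card = 0) :
    ∃ π : ZMod n → Equiv.Perm (ZMod m), ∀ i x, f (i, x) = (i + 1, π i x) := by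
  have hx : ∀ i x, x ∉ tails f i := by
    intro i x
    have := (hs.card_tails i i₀).trans h
    rw [Finset.card_eq_zero] at this
    simp [this]
  refine ⟨fun i => Equiv.ofBijective (fun x => (f (i, x)).2)
    (Finite.injective_iff_bijective.1 ?_), fun i x => hs.eq_of_notMem (hx i x)⟩
  intro x y hxy
  have h1 := hs.eq_of_notMem (hx i x)
  have h2 := hs.eq_of_notMem (hx i y)
  dsimp only at hxy
  rw [hxy, ← h2] at h1
  exact congrArg Prod.snd (f.injective h1)

/-- A permutation that takes one arc in each layer uses all but one of the vertices of a layer to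
move on, and enters all but one of the vertices of the next layer from there. The map between the
layers becomes a permutation when the two missing vertices are matched. -/
theorem IsWreathStep.exists_perm_of_card_eq_one (hs : IsWreathStep f) {i₀ : ZMod n}
    (h : (tails f i₀).card = 1) :
    ∃ (π : ZMod n → Equiv.Perm (ZMod m)) (t : ZMod n → ZMod m),
      (∀ i, tails f i = {t i}) ∧ (∀ i, π i (t i) = t (i + 1) + 1) ∧
      ∀ i x, x ≠ t i → f (i, x) = (i + 1, π i x) := by
  have h1 : ∀ i, ∃ t, tails f i = {t} := fun i =>
    Finset.card_eq_one.1 ((hs.card_tails i i₀).trans h)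
  choose t ht using h1
  have hx : ∀ i x, x ≠ t i → x ∉ tails f i := fun i x => by simp [ht]
  refine ⟨fun i => Equiv.ofBijective (fun x => if x = t i then t (i + 1) + 1 else (f (i, x)).2)
    (Finite.injective_iff_bijective.1 ?_), t, ht, fun i => by simp, fun i x hxt => ?_⟩
  · have new : ∀ x, x ≠ t i → (f (i, x)).2 ≠ t (i + 1) + 1 := by
      intro x hxt he
      have := hs.sub_notMem (hx i x hxt)
      rw [he, add_sub_cancel_right, ht, Finset.mem_singleton] at this
      exact this rfl
    intro x y hxy
    dsimp only at hxy
    split_ifs at hxy with h1 h2 h2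
    · rw [h1, h2]
    · exact (new y h2 hxy.symm).elim
    · exact (new x h1 hxy).elim
    · have h3 := hs.eq_of_notMem (hx i x h1)
      have h4 := hs.eq_of_notMem (hx i y h2)
      rw [hxy, ← h4] at h3
      exact congrArg Prod.snd (f.injective h3)
  · rw [hs.eq_of_notMem (hx i x hxt)]
    simp [hxt]

end Sign

/-! ### Wreath products with a cycle of length two or three -/

section Colours

variable {n m : ℕ} {K : Type*}
  {f : K → Equiv.Perm (ZMod n × ZMod m)}

theorem Digraph.IsPermDecomposition.isWreathStep
    (h : ((dicycle n).wreath (dicycle m)).IsPermDecomposition f) (c : K) :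
    IsWreathStep (f c) := by
  intro i x
  rcases (h.adj_iff (i, x) _).2 ⟨c, rfl⟩ with h | ⟨h, h'⟩
  · exact .inl h
  · exact .inr (Prod.ext h.symm h')

variable [NeZero m]

theorem Digraph.IsPermDecomposition.finite [NeZero n]
    (h : ((dicycle n).wreath (dicycle m)).IsPermDecomposition f) : Finite K :=
  Finite.of_injective (fun c => f c (0, 0)) fun c c' hc => h.color_inj c c' _ hc

/-- There are at least as many colours as arcs that leave a vertex. -/
theorem Digraph.IsPermDecomposition.lt_card [Fact (1 < n)] [Fintype K]
    (h : ((dicycle n).wreath (dicycle m)).IsPermDecomposition f) : m < Fintype.card K := by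
  let g : Option (ZMod m) → ZMod n × ZMod m := fun o => o.elim (0, 1) fun y => (1, y)
  have hg : ∀ o, ∃ c, f c (0, 0) = g o := by
    intro o
    refine (h.adj_iff _ _).1 ?_
    cases o with
    | none => exact .inr ⟨rfl, (zero_add 1).symm⟩
    | some y => exact .inl (zero_add 1).symm
  choose k hk using hg
  have hinj : Function.Injective k := by
    intro o o' ho
    have := (hk o).symm.trans ((congrArg (fun c => f c (0, 0)) ho).trans (hk o'))
    cases o <;> cases o' <;> simp_all [g]
  have := Fintype.card_le_of_injective k hinj
  rw [Fintype.card_option, ZMod.card] at this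
  omega

theorem Digraph.IsPermDecomposition.disjoint_tails
    (h : ((dicycle n).wreath (dicycle m)).IsPermDecomposition f) {c c' : K} (hc : c ≠ c')
    (i : ZMod n) : Disjoint (tails (f c) i) (tails (f c') i) := by
  rw [Finset.disjoint_left]
  intro x hx hx'
  exact hc (h.color_inj _ _ _ ((mem_tails.1 hx).trans (mem_tails.1 hx').symm))

theorem Digraph.IsPermDecomposition.sum_card_tails [Fintype K]
    (h : ((dicycle n).wreath (dicycle m)).IsPermDecomposition f) (i : ZMod n) :
    ∑ c, (tails (f c) i).card = m := by
  classical
  rw [← Finset.card_biUnion fun c _ c' _ hc => h.disjoint_tails hc i,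
    Finset.eq_univ_of_forall (s := Finset.univ.biUnion fun c => tails (f c) i), Finset.card_univ,
    ZMod.card]
  intro x
  obtain ⟨c, hc⟩ := (h.adj_iff (i, x) (i, x + 1)).1 (.inr ⟨rfl, rfl⟩)
  exact Finset.mem_biUnion.2 ⟨c, Finset.mem_univ _, mem_tails.2 hc⟩

end Colours

/-- The two permutations of two points have different signs. -/
theorem sign_eq_neg_of_ne (σ τ : Equiv.Perm (ZMod 2)) (h : σ ≠ τ) :
    Equiv.Perm.sign τ = -Equiv.Perm.sign σ := by
  have : ∀ σ τ : Equiv.Perm (Fin 2), σ ≠ τ → Equiv.Perm.sign τ = -Equiv.Perm.sign σ := by decide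
  exact this σ τ h

/-- Permutations of three points that differ everywhere differ by a rotation. -/
theorem sign_eq_of_forall_ne (σ τ : Equiv.Perm (ZMod 3)) (h : ∀ x, σ x ≠ τ x) :
    Equiv.Perm.sign τ = Equiv.Perm.sign σ := by
  have : ∀ σ τ : Equiv.Perm (Fin 3), (∀ x, σ x ≠ τ x) →
      Equiv.Perm.sign τ = Equiv.Perm.sign σ := by decide
  exact this σ τ h

/-- The permutations `π j`, without the arc from `H j` to `H' j`, and `δ` are disjoint, so they
decompose the complete bipartite graph on two triples. -/
theorem sign_mul_of_ne (H H' : Equiv.Perm (Fin 3)) (π : Fin 3 → Equiv.Perm (Fin 3))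
    (δ : Equiv.Perm (Fin 3)) (h : ∀ j : Fin 3, π j (H j) = H' j)
    (hπ : ∀ i j : Fin 3, i ≠ j → ∀ x, x ≠ H i → x ≠ H j → π i x ≠ π j x)
    (hδ : ∀ i : Fin 3, ∀ x, x ≠ H i → π i x ≠ δ x) :
    Equiv.Perm.sign (π 0) * Equiv.Perm.sign (π 1) * Equiv.Perm.sign (π 2) *
      Equiv.Perm.sign δ = -1 := by
  -- after multiplication by `H` and `H'⁻¹`, the permutation `π j` fixes `j`
  have core : ∀ ρ₀ : Equiv.Perm (Fin 3), ρ₀ 0 = 0 → ∀ ρ₁ : Equiv.Perm (Fin 3),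
      ρ₁ 1 = 1 → ρ₀ 2 ≠ ρ₁ 2 → ∀ ρ₂ : Equiv.Perm (Fin 3), ρ₂ 2 = 2 → ρ₀ 1 ≠ ρ₂ 1 →
      ρ₁ 0 ≠ ρ₂ 0 → ∀ δ : Equiv.Perm (Fin 3), (∀ x, x ≠ 0 → ρ₀ x ≠ δ x) →
      (∀ x, x ≠ 1 → ρ₁ x ≠ δ x) → (∀ x, x ≠ 2 → ρ₂ x ≠ δ x) →
      Equiv.Perm.sign ρ₀ * Equiv.Perm.sign ρ₁ * Equiv.Perm.sign ρ₂ * Equiv.Perm.sign δ = -1 := by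
    decide
  have fixed : ∀ j : Fin 3, (H'⁻¹ * π j * H) j = j := fun j => by
    rw [Equiv.Perm.mul_apply, Equiv.Perm.mul_apply, h, Equiv.Perm.inv_eq_iff_eq]
  have ne : ∀ (σ τ : Equiv.Perm (Fin 3)) x, σ (H x) ≠ τ (H x) →
      (H'⁻¹ * σ * H) x ≠ (H'⁻¹ * τ * H) x := fun σ τ x hne he =>
    hne (H'⁻¹.injective he)
  have neH : ∀ i j : Fin 3, i ≠ j → H i ≠ H j := fun i j hij he => hij (H.injective he)
  have := core (H'⁻¹ * π 0 * H) (fixed 0) (H'⁻¹ * π 1 * H) (fixed 1)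
    (ne _ _ 2 (hπ 0 1 (by decide) _ (neH 2 0 (by decide)) (neH 2 1 (by decide))))
    (H'⁻¹ * π 2 * H) (fixed 2)
    (ne _ _ 1 (hπ 0 2 (by decide) _ (neH 1 0 (by decide)) (neH 1 2 (by decide))))
    (ne _ _ 0 (hπ 1 2 (by decide) _ (neH 0 1 (by decide)) (neH 0 2 (by decide))))
    (H'⁻¹ * δ * H) (fun x hx => ne _ _ x (hδ 0 _ (neH x 0 hx)))
    (fun x hx => ne _ _ x (hδ 1 _ (neH x 1 hx))) (fun x hx => ne _ _ x (hδ 2 _ (neH x 2 hx)))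
  have sq : Equiv.Perm.sign H' * Equiv.Perm.sign H' = 1 ∧
      Equiv.Perm.sign H * Equiv.Perm.sign H = 1 :=
    ⟨Int.units_mul_self _, Int.units_mul_self _⟩
  simp only [map_mul, Equiv.Perm.sign_inv] at this
  rw [← this]
  calc _ = (Equiv.Perm.sign H' * Equiv.Perm.sign H') * (Equiv.Perm.sign H' * Equiv.Perm.sign H') *
        ((Equiv.Perm.sign H * Equiv.Perm.sign H) * (Equiv.Perm.sign H * Equiv.Perm.sign H)) *
        (Equiv.Perm.sign (π 0) * Equiv.Perm.sign (π 1) * Equiv.Perm.sign (π 2) *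
          Equiv.Perm.sign δ) := by
        rw [sq.1, sq.2]
        simp
    _ = _ := by ac_rfl

/-- One colour `C` takes no arcs within the layers and two colours take one. If `A` is one of the
latter, then `C` and the completion of `A` have opposite signs in each of the evenly many layers,
while the products of all signs have to differ. -/
theorem not_isPermDecomposition_two {n : ℕ} [NeZero n] [Fact (1 < n)] (hn : Even n) {K : Type*}
    {f : K → Equiv.Perm (ZMod n × ZMod 2)} :
    ¬ ((Digraph.dicycle n).wreath (Digraph.dicycle 2)).IsPermDecomposition f := by
  intro h
  have := h.finite
  have := Fintype.ofFinite K
  have hsum := h.sum_card_tails 0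
  have hK := h.lt_card
  have hlt : ∀ c, (tails (f c) 0).card < 2 := fun c => card_tails_lt (h.sameCycle c) 0
  obtain ⟨A, hA⟩ : ∃ c, (tails (f c) 0).card = 1 := by
    by_contra! hne
    have : ∀ c, (tails (f c) 0).card = 0 := fun c => by
      have := hlt c
      have := hne c
      omega
    simp [this] at hsum
  obtain ⟨C, hC⟩ : ∃ c, (tails (f c) 0).card = 0 := by
    by_contra! hne
    have := Finset.card_nsmul_le_sum Finset.univ (fun c => (tails (f c) 0).card) 1
      fun c _ => Nat.pos_of_ne_zero (hne c)
    rw [Finset.card_univ, hsum, smul_eq_mul] at this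
    omega
  obtain ⟨π, t, ht, hπ, hfA⟩ := (h.isWreathStep A).exists_perm_of_card_eq_one hA
  obtain ⟨σ, hfC⟩ := (h.isWreathStep C).exists_perm_of_card_eq_zero hC
  have hAC : A ≠ C := by
    rintro rfl
    omega
  have hsign : ∀ i, Equiv.Perm.sign (σ i) = -Equiv.Perm.sign (π i) := by
    intro i
    refine sign_eq_neg_of_ne _ _ fun he => hAC (h.color_inj _ _ (i, t i + 1) ?_)
    rw [hfA i _ (by simp), hfC, he]
  have h1 := prod_sign_of_tail hn (h.sameCycle A) (fun i => mem_tails.1 (by simp [ht])) hπ hfA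
  have h2 := prod_sign_of_forall hn (h.sameCycle C) hfC
  simp only [hsign, Finset.prod_neg, Finset.card_univ, ZMod.card, hn.neg_one_pow, one_mul] at h2
  rw [h1] at h2
  exact absurd h2 (by decide)

/-- The four colours take two, one, none and none of the arcs of a layer, or one, one, one and none.
In the first case, a colour with one arc and one without have the same signs throughout. In the
second case, the four signs have product `-1` in each layer. Both contradict the products over all
layers that transitivity prescribes. -/
theorem not_isPermDecomposition_three {n : ℕ} [NeZero n] [Fact (1 < n)] (hn : Even n) {K : Type*}
    {f : K → Equiv.Perm (ZMod n × ZMod 3)} :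
    ¬ ((Digraph.dicycle n).wreath (Digraph.dicycle 3)).IsPermDecomposition f := by
  classical
  intro h
  have := h.finite
  have := Fintype.ofFinite K
  have hsum := h.sum_card_tails 0
  have hK := h.lt_card
  have hlt : ∀ c, (tails (f c) 0).card < 3 := fun c => card_tails_lt (h.sameCycle c) 0
  obtain ⟨B, hB⟩ : ∃ c, (tails (f c) 0).card = 0 := by
    by_contra! hne
    have := Finset.card_nsmul_le_sum Finset.univ (fun c => (tails (f c) 0).card) 1
      fun c _ => Nat.pos_of_ne_zero (hne c)
    rw [Finset.card_univ, hsum, smul_eq_mul] at this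
    omega
  obtain ⟨σ, hfB⟩ := (h.isWreathStep B).exists_perm_of_card_eq_zero hB
  have hσ := prod_sign_of_forall hn (h.sameCycle B) hfB
  by_cases hD : ∃ c, (tails (f c) 0).card = 2
  · obtain ⟨D, hD⟩ := hD
    obtain ⟨A, hAD, hA0⟩ : ∃ c, c ≠ D ∧ (tails (f c) 0).card ≠ 0 := by
      by_contra! hne
      rw [Finset.sum_eq_single D (fun c _ hc => hne c hc) (by simp)] at hsum
      omega
    have hA : (tails (f A) 0).card = 1 := by
      have := Finset.sum_le_sum_of_subset (f := fun c => (tails (f c) 0).card)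
        (Finset.subset_univ {A, D})
      rw [hsum, Finset.sum_pair hAD] at this
      omega
    obtain ⟨π, t, ht, hπ, hfA⟩ := (h.isWreathStep A).exists_perm_of_card_eq_one hA
    have hAB : A ≠ B := by
      rintro rfl
      omega
    have hDB : D ≠ B := by
      rintro rfl
      omega
    have hDt : ∀ i, tails (f D) i = {t i}ᶜ := by
      intro i
      refine Finset.eq_of_subset_of_card_le ?_ ?_
      · rw [Finset.subset_compl_comm, Finset.singleton_subset_iff, Finset.mem_compl]
        exact Finset.disjoint_left.1 (h.disjoint_tails hAD i) (by simp [ht])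
      · rw [(h.isWreathStep D).card_tails i 0, hD, Finset.card_compl, Finset.card_singleton,
          ZMod.card]
    -- the arc that completes `A` is taken by `D`, so it is not taken by `B`
    have hfD : ∀ i, f D (i, t i) = (i + 1, t (i + 1) + 1) := by
      intro i
      have h1 : t i ∉ tails (f D) i := by simp [hDt]
      have h2 := (h.isWreathStep D).sub_notMem h1
      rw [hDt, Finset.mem_compl, not_not, Finset.mem_singleton, sub_eq_iff_eq_add] at h2
      rw [(h.isWreathStep D).eq_of_notMem h1, h2]
    have hsign : ∀ i, Equiv.Perm.sign (σ i) = Equiv.Perm.sign (π i) := by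
      intro i
      refine sign_eq_of_forall_ne _ _ fun x he => ?_
      by_cases hx : x = t i
      · subst hx
        exact hDB (h.color_inj _ _ (i, t i) (by rw [hfD, hfB, ← he, hπ]))
      · exact hAB (h.color_inj _ _ (i, x) (by rw [hfA i x hx, hfB, he]))
    have h1 := prod_sign_of_tail hn (h.sameCycle A) (fun i => mem_tails.1 (by simp [ht])) hπ hfA
    simp only [hsign, h1] at hσ
    exact absurd hσ (by decide)
  · push Not at hD
    have hle : ∀ c, (tails (f c) 0).card = if (tails (f c) 0).card = 1 then 1 else 0 := fun c => by
      have := hlt c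
      have := hD c
      split_ifs <;> omega
    have h3 : ({c | (tails (f c) 0).card = 1} : Finset K).card = 3 := by
      rw [Finset.card_filter, ← Finset.sum_congr rfl fun c _ => hle c, hsum]
    let e := (Finset.equivFinOfCardEq h3).symm
    let A : Fin 3 → K := fun j => (e j).1
    have hA : ∀ j, (tails (f (A j)) 0).card = 1 := fun j => (Finset.mem_filter.1 (e j).2).2
    have hAinj : ∀ i j, i ≠ j → A i ≠ A j := fun i j hij he => hij (e.injective (Subtype.ext he))
    have hAB : ∀ j, A j ≠ B := by
      intro j he
      have := hA j
      rw [he] at this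
      omega
    choose π t ht hπ hf using fun j =>
      (h.isWreathStep (A j)).exists_perm_of_card_eq_one (hA j)
    have htinj : ∀ i, Function.Injective fun j : Fin 3 => t j i := by
      intro i j k hjk
      by_contra hne
      exact Finset.disjoint_left.1 (h.disjoint_tails (hAinj j k hne) i)
        (show t j i ∈ tails (f (A j)) i by simp [ht]) (by simpa [ht] using hjk)
    let H : ZMod n → Equiv.Perm (ZMod 3) := fun i =>
      Equiv.ofBijective (fun j : Fin 3 => t j i) (Finite.injective_iff_bijective.1 (htinj i))
    have hlocal : ∀ i, Equiv.Perm.sign (π 0 i) * Equiv.Perm.sign (π 1 i) *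
        Equiv.Perm.sign (π 2 i) * Equiv.Perm.sign (σ i) = -1 := by
      intro i
      refine sign_mul_of_ne (H i) ((H (i + 1)).trans (Equiv.addRight 1)) (fun j => π j i) (σ i)
        (fun j => hπ j i) (fun j k hjk (x : ZMod 3) hxj hxk he => hAinj j k hjk ?_)
        fun j (x : ZMod 3) hx he => hAB j ?_
      · exact h.color_inj _ _ (i, x) ((hf j i x hxj).trans
          ((congrArg (Prod.mk (i + 1)) he).trans (hf k i x hxk).symm))
      · exact h.color_inj _ _ (i, x) ((hf j i x hx).trans
          ((congrArg (Prod.mk (i + 1)) he).trans (hfB i x).symm))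
    have hprod := Finset.prod_congr (rfl : (Finset.univ : Finset (ZMod n)) = _) fun i _ => hlocal i
    have hj := fun j => prod_sign_of_tail hn (h.sameCycle (A j))
      (fun i => mem_tails.1 (by simp [ht])) (hπ j) (hf j)
    rw [Finset.prod_const, Finset.card_univ, ZMod.card, hn.neg_one_pow] at hprod
    simp only [Finset.prod_mul_distrib] at hprod
    have hneg : ∀ x y : ℤˣ, (-1) ^ 3 * x = y → x = -y := by decide
    rw [hneg _ _ (hj 0), hneg _ _ (hj 1), hneg _ _ (hj 2), hneg _ _ hσ] at hprod
    exact absurd hprod (by decide)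

theorem theorem2 :
    (∀ (V : Type*) [Fintype V] (G : Digraph V) (n m : ℕ),
      G.HamiltonianDecomposable → Fintype.card V = n → Even n →
      ((Even m ∧ 4 ≤ m ∧ 4 ≤ n) ∨ (m = 4 ∧ n = 2) ∨ (Odd m ∧ 5 ≤ m)) →
      (G.wreath (Digraph.dicycle m)).HamiltonianDecomposable) ∧
    (∀ n m : ℕ, 0 < n → Even n → (m = 2 ∨ m = 3) →
      ¬ ((Digraph.dicycle n).wreath (Digraph.dicycle m)).HamiltonianDecomposable) := by
  constructor
  · rintro V _ G n m hG rfl hn hm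
    have h4 : 4 ≤ m := by omega
    have : NeZero m := ⟨by omega⟩
    exact hG.wreath_dicycle hn (hasBlocks_of_four_le h4)
  · intro n m h0 hn hm h
    have : NeZero n := ⟨h0.ne'⟩
    have : Fact (1 < n) := ⟨by obtain ⟨k, rfl⟩ := hn; omega⟩
    obtain ⟨D, f, hf⟩ := h.exists_isPermDecomposition
    rcases hm with rfl | rfl
    exacts [not_isPermDecomposition_two hn hf, not_isPermDecomposition_three hn hf]
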